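/- Let $\mathbb{F}$ be a field of characteristic $2$ with algebraic closure $\overline{\mathbb{F}}$, and let $p,q\in\mathbb{F}[t]$ be monic irreducible polynomials of degree $2$ whose splitting fields in $\overline{\mathbb{F}}$ are distinct. For a monic polynomial $f$ of degree $2$, let $\operatorname{tr} f$ denote the opposite of the coefficient of $f$ on $t$, and assume that $\operatorname{tr} p=\operatorname{tr} q\neq 0$. Let $V$ be a finite-dimensional vector space over $\mathbb{F}$. Given a bilinear form $b$ on $V$, an endomorphism $w$ of $V$ is called $b$-alternating if $b(x,w(x))=0$ for all $x\in V$. Let $(b,u)$ be a symplectic pair on $V$, i.e. $b$ is a symplectic (alternating and nondegenerate) bilinear form on $V$ and $u$ is a $b$-alternating endomorphism of $V$. Assume that $u$ is $(p,q)$-exceptional, i.e. $V=\bigcup_{n\in\mathbb{N}}\operatorname{Ker} F_{p,q}(u)^n$, where $F_{p,q}(t):=\operatorname{res}_x\bigl(p(x),q(x-t)\bigr)\in\mathbb{F}[t]$ (equivalently, all the eigenvalues of $u$ in $\overline{\mathbb{F}}$ are of the form $x-y$ with $x$ a root of $p$ and $y$ a root of $q$). Then the following conditions are equivalent: (i) $(b,u)$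 is a symplectic $(p,q)$-difference, i.e. there exist $b$-alternating endomorphisms $u_1,u_2$ of $V$ such that $p(u_1)=q(u_2)=0$ and $u=u_1-u_2$; (ii) for every odd integer $k\geq 1$, the number of invariant factors of $u$ that equal $\bigl(t^2-(\operatorname{tr} p)\,t+p(0)+q(0)\bigr)^k$ is a multiple of $4$. -/

import Mathlib

open Polynomial

/-- The trace of a monic polynomial of positive degree `n`: the opposite of its coefficient
on `t ^ (n - 1)`. -/
noncomputable def polyTrace {F : Type*} [Field F] (p : F[X]) : F :=
  -p.nextCoeff

/-- The splitting field of `p` inside the algebraic closure of `F`. -/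
noncomputable def splittingFieldInClosure {F : Type*} [Field F] (p : F[X]) :
    IntermediateField F (AlgebraicClosure F) :=
  IntermediateField.adjoin F (p.rootSet (AlgebraicClosure F))

/-- The fundamental polynomial `F_{p,q}(t) = res_x (p(x), q(x - t))`. In `F[X][X]`, the outer
variable `X` is `x` and the inner one, `C X`, is `t`. -/
noncomputable def fundamentalPolynomial {F : Type*} [Field F] (p q : F[X]) : F[X] :=
  Polynomial.resultant (p.map (C : F →+* F[X])) ((q.map (C : F →+* F[X])).comp (X - C X))

section Endomorphisms

variable {F V : Type*} [Field F] [AddCommGroup V] [Module F V]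

/-- `u` is `(p,q)`-exceptional: the union over `n` of the kernels of `F_{p,q}(u) ^ n` is `V`. -/
def IsExceptional (p q : F[X]) (u : Module.End F V) : Prop :=
  (⋃ n : ℕ, (LinearMap.ker (aeval u (fundamentalPolynomial p q) ^ n) : Set V)) = Set.univ

/-- `u` is `b`-alternating. -/
def IsAlternatingFor (b : LinearMap.BilinForm F V) (u : Module.End F V) : Prop :=
  ∀ x : V, b x (u x) = 0

/-- `(b, u)` is a symplectic pair: `b` is alternating and nondegenerate, and `u` is
`b`-alternating. -/
structure IsSymplecticPair (b : LinearMap.BilinForm F V) (u : Module.End F V) : Prop where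
  isAlt : b.IsAlt
  nondegenerate : b.Nondegenerate
  alternating : IsAlternatingFor b u

/-- `(b, u)` is a symplectic `(p,q)`-difference. -/
structure IsSymplecticDifference (p q : F[X]) (b : LinearMap.BilinForm F V)
    (u : Module.End F V) : Prop where
  isSymplecticPair : IsSymplecticPair b u
  exists_sub : ∃ u₁ u₂ : Module.End F V, IsAlternatingFor b u₁ ∧ IsAlternatingFor b u₂ ∧
    aeval u₁ p = 0 ∧ aeval u₂ q = 0 ∧ u = u₁ - u₂

/-- `l = [p₁, p₂, …, pₙ]` is the list of (nonconstant) invariant factors of `u`: the `pᵢ` are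
monic and different from `1`, each one is divisible by all the following ones, and `V`, as the
`F[X]`-module on which `X` acts as `u`, is isomorphic to the product of the `F[X] ⧸ (pᵢ)`. -/
structure IsInvariantFactorList (u : Module.End F V) (l : List F[X]) : Prop where
  monic : ∀ f ∈ l, f.Monic
  ne_one : ∀ f ∈ l, f ≠ 1
  dvd : l.Pairwise (fun f g => g ∣ f)
  equiv : Nonempty (Module.AEval' u ≃ₗ[F[X]]
    ((i : Fin l.length) → F[X] ⧸ Ideal.span {l.get i}))

end Endomorphisms

/-! Existence of the invariant factors. -/

section Existence

variable {F : Type*} [Field F]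

theorem quotient_prod_equiv_lcm_gcd (a b : F[X]) (ha : a.Monic) (hb : b.Monic) :
    ∃ m d : F[X], m.Monic ∧ d.Monic ∧ a ∣ m ∧ b ∣ m ∧ d ∣ a ∧ d ∣ b ∧
      (∀ c, a ∣ c → b ∣ c → m ∣ c) ∧
      Nonempty (((F[X] ⧸ Ideal.span {a}) × (F[X] ⧸ Ideal.span {b})) ≃ₗ[F[X]]
        ((F[X] ⧸ Ideal.span {m}) × (F[X] ⧸ Ideal.span {d}))) := by
  classical
  obtain ⟨d, hd, a', b', x, y, rfl, rfl, hxy⟩ : ∃ d : F[X], d.Monic ∧ ∃ a' b' x y : F[X],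
      a = d * a' ∧ b = d * b' ∧ x * a' + y * b' = 1 := by
    have h0 : EuclideanDomain.gcd a b ≠ 0 := fun h =>
      ha.ne_zero (EuclideanDomain.gcd_eq_zero_iff.1 h).1
    have hn : normalize (EuclideanDomain.gcd a b) ≠ 0 := by simpa using h0
    obtain ⟨a', h1⟩ : normalize (EuclideanDomain.gcd a b) ∣ a :=
      normalize_dvd_iff.2 (EuclideanDomain.gcd_dvd_left a b)
    obtain ⟨b', h2⟩ : normalize (EuclideanDomain.gcd a b) ∣ b :=
      normalize_dvd_iff.2 (EuclideanDomain.gcd_dvd_right a b)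
    obtain ⟨c, hc⟩ : EuclideanDomain.gcd a b ∣ normalize (EuclideanDomain.gcd a b) :=
      dvd_normalize_iff.2 dvd_rfl
    have hbez := EuclideanDomain.gcd_eq_gcd_ab a b
    refine ⟨_, Polynomial.monic_normalize h0, a', b', c * EuclideanDomain.gcdA a b,
      c * EuclideanDomain.gcdB a b, h1, h2, mul_left_cancel₀ hn ?_⟩
    generalize normalize (EuclideanDomain.gcd a b) = n at *
    calc n * (c * EuclideanDomain.gcdA a b * a' + c * EuclideanDomain.gcdB a b * b')
        = c * ((n * a') * EuclideanDomain.gcdA a b + (n * b') * EuclideanDomain.gcdB a b) := by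
          ring
      _ = n * 1 := by rw [← h1, ← h2, ← hbez, hc]; ring
  have ha' : a'.Monic := hd.of_mul_monic_left ha
  have hb' : b'.Monic := hd.of_mul_monic_left hb
  refine ⟨d * a' * b', d, ha.mul hb', hd, ⟨b', rfl⟩, ⟨a', by ring⟩, ⟨a', rfl⟩, ⟨b', rfl⟩, ?_, ?_⟩
  · rintro c ⟨s, rfl⟩ ⟨t, ht⟩
    have h : a' * s = b' * t := mul_left_cancel₀ hd.ne_zero (by linear_combination ht)
    refine ⟨x * t + y * s, ?_⟩
    linear_combination (-d * a' * s) * hxy + (d * a' * x) * h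
  · let e : (F[X] × F[X]) ≃ₗ[F[X]] (F[X] × F[X]) :=
      { toFun := fun s => (b' * s.1 - a' * s.2, x * s.1 + y * s.2)
        invFun := fun s => (y * s.1 + a' * s.2, -x * s.1 + b' * s.2)
        map_add' := by intro s t; ext1 <;> simp <;> ring
        map_smul' := by intro c s; ext1 <;> simp <;> ring
        left_inv := by
          intro s
          ext1
          · simp only
            linear_combination s.1 * hxy
          · simp only
            linear_combination s.2 * hxy
        right_inv := by
          intro s
          ext1
          · simp only
            linear_combination s.1 * hxy
          · simp only
            linear_combination s.2 * hxy }
    let f₁ : (F[X] × F[X]) →ₗ[F[X]]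
        ((F[X] ⧸ Ideal.span {d * a'}) × (F[X] ⧸ Ideal.span {d * b'})) :=
      LinearMap.prodMap (Submodule.mkQ _) (Submodule.mkQ _)
    let f₂ : (F[X] × F[X]) →ₗ[F[X]]
        ((F[X] ⧸ Ideal.span {d * a' * b'}) × (F[X] ⧸ Ideal.span {d})) :=
      LinearMap.prodMap (Submodule.mkQ _) (Submodule.mkQ _)
    have hf₁ : Function.Surjective f₁ :=
      Function.Surjective.prodMap (Submodule.mkQ_surjective _) (Submodule.mkQ_surjective _)
    have hf₂ : Function.Surjective f₂ :=
      Function.Surjective.prodMap (Submodule.mkQ_surjective _) (Submodule.mkQ_surjective _)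
    have m₁ : ∀ s, s ∈ LinearMap.ker f₁ ↔ d * a' ∣ s.1 ∧ d * b' ∣ s.2 := by
      intro s
      simp [f₁, Ideal.mem_span_singleton]
    have m₂ : ∀ s, s ∈ LinearMap.ker f₂ ↔ d * a' * b' ∣ s.1 ∧ d ∣ s.2 := by
      intro s
      simp [f₂, Ideal.mem_span_singleton]
    have hmap : (LinearMap.ker f₁).map (e : (F[X] × F[X]) →ₗ[F[X]] (F[X] × F[X]))
        = LinearMap.ker f₂ := by
      ext s
      constructor
      · rintro ⟨t, ht, rfl⟩
        obtain ⟨⟨v, hv⟩, ⟨w, hw⟩⟩ := (m₁ t).1 ht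
        refine (m₂ _).2 ⟨⟨v - w, ?_⟩, ⟨x * a' * v + y * b' * w, ?_⟩⟩
        · change b' * t.1 - a' * t.2 = _
          rw [hv, hw]; ring
        · change x * t.1 + y * t.2 = _
          rw [hv, hw]; ring
      · intro hs
        obtain ⟨⟨v, hv⟩, ⟨w, hw⟩⟩ := (m₂ s).1 hs
        refine ⟨e.symm s, (m₁ _).2 ⟨⟨y * b' * v + w, ?_⟩, ⟨-x * a' * v + w, ?_⟩⟩,
          e.apply_symm_apply s⟩
        · change y * s.1 + a' * s.2 = _
          rw [hv, hw]; ring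
        · change -x * s.1 + b' * s.2 = _
          rw [hv, hw]; ring
    exact ⟨(f₁.quotKerEquivOfSurjective hf₁).symm.trans
      ((Submodule.Quotient.equiv _ _ e hmap).trans (f₂.quotKerEquivOfSurjective hf₂))⟩

theorem exists_insert_invariant_factor (l : List F[X]) :
    (∀ f ∈ l, f.Monic) → (∀ f ∈ l, f ≠ 1) → l.Pairwise (fun f g => g ∣ f) →
    ∀ a : F[X], a.Monic → ∃ l' : List F[X],
      (∀ f ∈ l', f.Monic) ∧ (∀ f ∈ l', f ≠ 1) ∧ l'.Pairwise (fun f g => g ∣ f) ∧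
      (∀ c, a ∣ c → (∀ f ∈ l, f ∣ c) → ∀ f ∈ l', f ∣ c) ∧
      Nonempty (((F[X] ⧸ Ideal.span {a}) ×
          ((i : Fin l.length) → F[X] ⧸ Ideal.span {l.get i})) ≃ₗ[F[X]]
        ((i : Fin l'.length) → F[X] ⧸ Ideal.span {l'.get i})) := by
  have cons : ∀ (f : F[X]) (t : List F[X]), Nonempty (((F[X] ⧸ Ideal.span {f}) ×
          ((i : Fin t.length) → F[X] ⧸ Ideal.span {t.get i})) ≃ₗ[F[X]]
        ((i : Fin (f :: t).length) → F[X] ⧸ Ideal.span {(f :: t).get i})) := fun f t =>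
    ⟨Fin.consLinearEquiv F[X]
      (fun i : Fin (t.length + 1) => F[X] ⧸ Ideal.span {(f :: t).get i})⟩
  induction l with
  | nil =>
    intro _ _ _ a ha
    by_cases h1 : a = 1
    · subst h1
      refine ⟨[], by simp, by simp, by simp, by simp, ?_⟩
      have : Subsingleton (F[X] ⧸ Ideal.span {(1 : F[X])}) :=
        Ideal.Quotient.subsingleton_iff.2 (by simp)
      exact ⟨{
        toFun := fun _ i => i.elim0
        invFun := fun _ => (0, fun i => i.elim0)
        map_add' := fun _ _ => funext fun i => i.elim0
        map_smul' := fun _ _ => funext fun i => i.elim0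
        left_inv := fun _ => Prod.ext (Subsingleton.elim _ _) (funext fun i => i.elim0)
        right_inv := fun _ => funext fun i => i.elim0 }⟩
    · refine ⟨[a], by simpa using ha, by simpa using h1, by simp, ?_, cons a []⟩
      intro c hc _ f hf
      simpa using (List.mem_singleton.1 hf) ▸ hc
  | cons g t ih =>
    intro hm h1 hp a ha
    obtain ⟨m, d, hmm, hdm, ham, hgm, hda, hdg, hmin, ⟨e⟩⟩ :=
      quotient_prod_equiv_lcm_gcd a g ha (hm g (by simp))
    rw [List.pairwise_cons] at hp
    obtain ⟨t', ht'm, ht'1, ht'p, ht'd, ⟨e'⟩⟩ := ih (fun f hf => hm f (by simp [hf]))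
      (fun f hf => h1 f (by simp [hf])) hp.2 d hdm
    refine ⟨m :: t', ?_, ?_, ?_, ?_, ?_⟩
    · rintro f hf
      rcases List.mem_cons.1 hf with rfl | hf
      exacts [hmm, ht'm f hf]
    · rintro f hf
      rcases List.mem_cons.1 hf with rfl | hf
      · rintro rfl
        exact h1 g (by simp) ((hm g (by simp)).eq_one_of_isUnit (isUnit_of_dvd_one hgm))
      · exact ht'1 f hf
    · rw [List.pairwise_cons]
      exact ⟨ht'd m (hda.trans ham) (fun f hf => (hp.1 f hf).trans hgm), ht'p⟩
    · intro c hac hc f hf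
      rcases List.mem_cons.1 hf with rfl | hf
      · exact hmin c hac (hc g (by simp))
      · exact ht'd c (hda.trans hac) (fun f hf => hc f (by simp [hf])) f hf
    · obtain ⟨c₁⟩ := cons g t
      obtain ⟨c₂⟩ := cons m t'
      exact ⟨((LinearEquiv.refl _ _).prodCongr c₁.symm).trans
        ((LinearEquiv.prodAssoc F[X] _ _ _).symm.trans
          ((e.prodCongr (LinearEquiv.refl _ _)).trans
            ((LinearEquiv.prodAssoc F[X] _ _ _).trans
              (((LinearEquiv.refl _ _).prodCongr e').trans c₂))))⟩

theorem exists_invariant_factors_of_family (n : ℕ) (f : Fin n → F[X]) (hf : ∀ i, (f i).Monic) :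
    ∃ l : List F[X], (∀ f ∈ l, f.Monic) ∧ (∀ f ∈ l, f ≠ 1) ∧ l.Pairwise (fun f g => g ∣ f) ∧
      Nonempty (((i : Fin n) → F[X] ⧸ Ideal.span {f i}) ≃ₗ[F[X]]
        ((i : Fin l.length) → F[X] ⧸ Ideal.span {l.get i})) := by
  induction n with
  | zero =>
    exact ⟨[], by simp, by simp, by simp, ⟨{
      toFun := fun _ i => i.elim0
      invFun := fun _ i => i.elim0
      map_add' := fun _ _ => funext fun i => i.elim0
      map_smul' := fun _ _ => funext fun i => i.elim0
      left_inv := fun _ => funext fun i => i.elim0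
      right_inv := fun _ => funext fun i => i.elim0 }⟩⟩
  | succ n ih =>
    obtain ⟨l, h1, h2, h3, ⟨e⟩⟩ := ih (fun i => f i.succ) (fun i => hf i.succ)
    obtain ⟨l', h1', h2', h3', -, ⟨e'⟩⟩ := exists_insert_invariant_factor l h1 h2 h3 (f 0) (hf 0)
    exact ⟨l', h1', h2', h3', ⟨(Fin.consLinearEquiv F[X]
      (fun i : Fin (n + 1) => F[X] ⧸ Ideal.span {f i})).symm.trans
        (((LinearEquiv.refl _ _).prodCongr e).trans e')⟩⟩

theorem exists_isInvariantFactorList {V : Type*} [AddCommGroup V] [Module F V]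
    [FiniteDimensional F V] (u : Module.End F V) :
    ∃ l : List F[X], IsInvariantFactorList u l := by
  classical
  obtain ⟨ι, _, p, hp, k, ⟨e⟩⟩ := Module.equiv_directSum_of_isTorsion
    (Module.AEval.isTorsion_of_finiteDimensional F V u)
  let σ := Fintype.equivFin ι
  obtain ⟨l, h1, h2, h3, ⟨e'⟩⟩ := exists_invariant_factors_of_family (Fintype.card ι)
    (fun i => normalize (p (σ.symm i) ^ k (σ.symm i)))
    (fun i => Polynomial.monic_normalize (pow_ne_zero _ (hp _).ne_zero))
  have e₁ : ((i : ι) → F[X] ⧸ Submodule.span F[X] {p i ^ k i}) ≃ₗ[F[X]]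
      ((j : Fin (Fintype.card ι)) → F[X] ⧸ Submodule.span F[X] {p (σ.symm j) ^ k (σ.symm j)}) :=
    LinearEquiv.piCongrLeft' F[X] (fun i => F[X] ⧸ Submodule.span F[X] {p i ^ k i}) σ
  refine ⟨l, h1, h2, h3, ⟨(e.trans (DirectSum.linearEquivFunOnFintype F[X] ι _)).trans
    ((e₁.trans (LinearEquiv.piCongrRight fun i => Submodule.quotEquivOfEq _ _ ?_)).trans e')⟩⟩
  exact Ideal.span_singleton_eq_span_singleton.2 (normalize_associated _).symm

end Existence

/-- The invariant factors of `u`, each divisible by the next one; the constant ones, equal to `1`,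
are left out. -/
noncomputable def invariantFactors {F V : Type*} [Field F] [AddCommGroup V] [Module F V]
    [FiniteDimensional F V] (u : Module.End F V) : List F[X] :=
  (exists_isInvariantFactorList u).choose

theorem isInvariantFactorList_invariantFactors {F V : Type*} [Field F] [AddCommGroup V]
    [Module F V] [FiniteDimensional F V] (u : Module.End F V) :
    IsInvariantFactorList u (invariantFactors u) :=
  (exists_isInvariantFactorList u).choose_spec

/-! In characteristic 2 write p = t² + τt + a, q = t² + τt + c and d = t² + τt + a + c. Then F_{p,q}
= d², and d is irreducible, since a root of d in F would translate the roots of p onto those of q.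
With D = d(u) and v = u₁, a (p,q)-difference amounts to a b-alternating v such that p(v) = 0 and vu
+ uv = D (`HasPartner`). Such a v satisfies vD + Dv = τD, so it commutes with D² but not with D:
this is where the parity of the exponent enters.

Necessity (`HasPartner.eight_dvd_blockDim`): on Ker D^(2m+1) the form b(x, D^(2m) y) is alternating,
with u and v self-adjoint. Modulo its radical, u and v commute and are annihilated by d and p, so
they generate a field of degree 4 over F. A maximal invariant isotropic subspace is Lagrangian, so
the dimension of the quotient is a multiple of 8. This dimension is twice the number of invariant
factors d^(2m+1).

Sufficiency (`hasPartner_of_eight_dvd_blockDim`): V splits orthogonally into hyperbolic blocks R × R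
with R = F[t]/(d^(k+1)), on which u is multiplication by t. The form of a block depends on a
functional l on R, which is free up to l(d^k) ≠ 0. The derivation δ = d·d/dt satisfies δ(t) = d(t)
and δ² = τδ, so v = M + δ with M a companion matrix of p has the required relations. With l∘δ = kτ
l, such a v is alternating on one block if k is odd, and on a sum of two blocks if k is even. Hence
only odd exponents k + 1 impose a condition: blocks come in pairs, and each block carries two
invariant factors. -/

section Quadratic

/-! ### Quadratic polynomials in characteristic 2 and their irreducibility. -/

variable {F : Type*} [Field F]

/-- The polynomial `t² + τ t + a`. -/
noncomputable def quadPoly (τ a : F) : F[X] := X ^ 2 + C τ * X + C a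

theorem quadPoly_monic (τ a : F) : (quadPoly τ a).Monic := by
  unfold quadPoly; monicity!

theorem quadPoly_natDegree (τ a : F) : (quadPoly τ a).natDegree = 2 := by
  unfold quadPoly; compute_degree!

theorem eq_quadPoly [CharP F 2] {p : F[X]} (hp : p.Monic) (hp2 : p.natDegree = 2) :
    p = quadPoly (polyTrace p) (p.eval 0) := by
  have h1 : p.nextCoeff = p.coeff 1 := by
    rw [nextCoeff_of_natDegree_pos (by omega), hp2]
  have h2 : p.coeff 2 = 1 := by rw [← hp2]; exact hp
  conv_lhs => rw [p.as_sum_range_C_mul_X_pow]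
  rw [hp2, polyTrace, h1, CharTwo.neg_eq, ← coeff_zero_eq_eval_zero, quadPoly]
  simp [Finset.sum_range_succ, h2]
  ring

/-- In characteristic 2, q(x - t) = p(x) + d(t) with d = t² + τt + a + c. The resultant of p with
this polynomial is that of p with the constant d(t), namely d(t)² because p is monic of degree 2. -/
theorem fundamentalPolynomial_quadPoly [CharP F 2] (τ a c : F) :
    fundamentalPolynomial (quadPoly τ a) (quadPoly τ c) = quadPoly τ (a + c) ^ 2 := by
  have h2 : (2 : F[X][X]) = 0 := CharTwo.two_eq_zero
  have h1 : ((quadPoly τ c).map (C : F →+* F[X])).comp (X - C X) =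
      C (quadPoly τ (a + c)) + (quadPoly τ a).map (C : F →+* F[X]) * 1 := by
    simp only [quadPoly, Polynomial.map_add, Polynomial.map_mul, Polynomial.map_pow, map_X, map_C,
      add_comp, mul_comp, pow_comp, X_comp, C_comp, map_add, map_mul, map_pow]
    linear_combination (-X * C X - C (C τ) * C X - C (C a)) * h2
  have h3 : ((quadPoly τ a).map (C : F →+* F[X])).natDegree = 2 := by
    rw [natDegree_map, quadPoly_natDegree]
  have h4 : (((quadPoly τ c).map (C : F →+* F[X])).comp (X - C X)).natDegree = 2 := by
    rw [natDegree_comp, natDegree_map, quadPoly_natDegree, natDegree_X_sub_C]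
  have h5 : ((quadPoly τ a).map (C : F →+* F[X])).coeff 2 = 1 := by
    have := ((quadPoly_monic τ a).map (C : F →+* F[X]))
    rwa [Monic, leadingCoeff, h3] at this
  rw [fundamentalPolynomial, h4, h3, h1, resultant_add_mul_right _ _ _ _ _ (by simp) h3.le,
    resultant_C_right, h5]
  simp

/-- Translation by r ∈ F exchanges the roots of the two polynomials. -/
theorem splittingFieldInClosure_quadPoly_eq_of_root [CharP F 2] {τ a c r : F}
    (hr : r ^ 2 + τ * r + (a + c) = 0) :
    splittingFieldInClosure (quadPoly τ a) = splittingFieldInClosure (quadPoly τ c) := by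
  have key : ∀ a c : F, r ^ 2 + τ * r + (a + c) = 0 →
      splittingFieldInClosure (quadPoly τ a) ≤ splittingFieldInClosure (quadPoly τ c) := by
    intro a c hr
    have h2 : (2 : AlgebraicClosure F) = 0 := by
      rw [← map_ofNat (algebraMap F (AlgebraicClosure F)) 2, CharTwo.two_eq_zero, map_zero]
    unfold splittingFieldInClosure
    rw [IntermediateField.adjoin_le_iff]
    intro x hx
    rw [mem_rootSet] at hx
    have hr' := congrArg (algebraMap F (AlgebraicClosure F)) hr
    have hxr : x + algebraMap F _ r ∈ (quadPoly τ c).rootSet (AlgebraicClosure F) := by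
      rw [mem_rootSet]
      refine ⟨(quadPoly_monic τ c).ne_zero, ?_⟩
      have := hx.2
      simp only [quadPoly, map_add, map_mul, map_pow, aeval_X, aeval_C, map_zero] at this hr' ⊢
      linear_combination this + hr' + (x * algebraMap F _ r - algebraMap F _ a) * h2
    have h3 := sub_mem (IntermediateField.subset_adjoin F _ hxr)
      (IntermediateField.algebraMap_mem (IntermediateField.adjoin F
        ((quadPoly τ c).rootSet (AlgebraicClosure F))) r)
    simpa using h3
  exact le_antisymm (key a c hr) (key c a (by rw [← hr]; ring))

theorem irreducible_quadPoly_iff {τ a : F} :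
    Irreducible (quadPoly τ a) ↔ ∀ r : F, r ^ 2 + τ * r + a ≠ 0 := by
  have h : ∀ r, r ^ 2 + τ * r + a = (quadPoly τ a).eval r := fun r => by simp [quadPoly]
  constructor
  · intro hi r hr
    have := natDegree_eq_of_degree_eq_some (n := 1)
      (degree_eq_one_of_irreducible_of_root hi (x := r) (by rw [IsRoot, ← h, hr]))
    rw [quadPoly_natDegree] at this
    omega
  · intro hr
    refine irreducible_of_degree_le_three_of_not_isRoot ?_ fun x hx => hr x ?_
    · rw [quadPoly_natDegree]; decide
    · rw [h]; exact hx

/-- This makes F[t]/(d) ⊗ F[t]/(p) a field of degree 4. A root α + βz of p, with z² = τz + a + c,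
must satisfy β² = β. If β = 0 then α is a root of p, and if β = 1 it is a root of q. -/
theorem irreducible_quadPoly_adjoinRoot [CharP F 2] {τ a c : F} (hτ : τ ≠ 0)
    (ha : Irreducible (quadPoly τ a)) (hc : Irreducible (quadPoly τ c))
    [Fact (Irreducible (quadPoly τ (a + c)))] :
    Irreducible (quadPoly (AdjoinRoot.of (quadPoly τ (a + c)) τ)
      (AdjoinRoot.of (quadPoly τ (a + c)) a)) := by
  rw [irreducible_quadPoly_iff] at ha hc ⊢
  set d := quadPoly τ (a + c) with hd
  have h2 : (2 : F) = 0 := CharTwo.two_eq_zero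
  have h2' : (2 : AdjoinRoot d) = 0 := by
    rw [← map_ofNat (AdjoinRoot.of d) 2, h2, map_zero]
  have hz : AdjoinRoot.root d ^ 2 + AdjoinRoot.of d τ * AdjoinRoot.root d
      + AdjoinRoot.of d (a + c) = 0 := by
    have := AdjoinRoot.eval₂_root d
    simpa [hd, quadPoly] using this
  have hind : ∀ α β : F, AdjoinRoot.of d α + AdjoinRoot.of d β * AdjoinRoot.root d = 0 →
      α = 0 ∧ β = 0 := by
    intro α β h
    have h1 : AdjoinRoot.mk d (C β * X + C α) = 0 := by
      rw [← h]; simp; ring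
    rw [AdjoinRoot.mk_eq_zero] at h1
    have h3 := eq_zero_of_dvd_of_degree_lt h1 (by
      rw [degree_eq_natDegree (quadPoly_monic _ _).ne_zero, quadPoly_natDegree]
      exact lt_of_le_of_lt degree_linear_le (by norm_num))
    have h4 := congrArg (fun f => coeff f 0) h3
    have h5 := congrArg (fun f => coeff f 1) h3
    simp at h4 h5
    exact ⟨h4, h5⟩
  intro r hr
  obtain ⟨f, rfl⟩ := AdjoinRoot.mk_surjective r
  obtain ⟨α, β, hf⟩ : ∃ α β : F, AdjoinRoot.mk d f =
      AdjoinRoot.of d α + AdjoinRoot.of d β * AdjoinRoot.root d := by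
    have hdeg : d.natDegree = 2 := quadPoly_natDegree τ (a + c)
    have hle : (f %ₘ d).natDegree ≤ 1 := by
      have := natDegree_modByMonic_lt f (show d.Monic from quadPoly_monic τ (a + c))
        (fun h => by rw [h, natDegree_one] at hdeg; omega)
      omega
    obtain ⟨β, α, h⟩ := exists_eq_X_add_C_of_natDegree_le_one hle
    refine ⟨α, β, ?_⟩
    rw [← modByMonic_add_div f d, h, map_add, map_mul, AdjoinRoot.mk_self]
    simp
    ring
  rw [hf] at hr
  obtain ⟨h3, h4⟩ := hind (α ^ 2 + β ^ 2 * (a + c) + τ * α + a) (β ^ 2 * τ + τ * β) (by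
    simp only [map_add, map_mul, map_pow] at hr hz ⊢
    linear_combination hr - AdjoinRoot.of d β ^ 2 * hz +
      (AdjoinRoot.of d β ^ 2 * (AdjoinRoot.of d a + AdjoinRoot.of d c +
        AdjoinRoot.of d τ * AdjoinRoot.root d) -
        AdjoinRoot.of d α * AdjoinRoot.of d β * AdjoinRoot.root d) * h2')
  have h5 : β = 0 ∨ β + 1 = 0 := by
    rw [← mul_eq_zero, ← mul_right_inj' hτ, mul_zero, ← h4]
    ring
  rcases h5 with rfl | h5
  · exact ha α (by linear_combination h3)
  · have h6 : β = 1 := by linear_combination h5 - h2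
    subst h6
    exact hc α (by linear_combination h3 - a * h2)

end Quadratic

/-! ### Reformulation of the difference problem with a single endomorphism. -/

section Partner

variable {F V : Type*} [Field F] [AddCommGroup V] [Module F V]

/-- There is a `b`-alternating `v` with `v² = τ v + a` and `v u + u v = u² + τ u + e`. -/
def HasPartner (τ a e : F) (b : LinearMap.BilinForm F V) (u : Module.End F V) : Prop :=
  ∃ v : Module.End F V, IsAlternatingFor b v ∧ (∀ x, v (v x) = τ • v x + a • x) ∧
    ∀ x, v (u x) + u (v x) = u (u x) + τ • u x + e • x

theorem aeval_quadPoly_apply (τ a : F) (v : Module.End F V) (x : V) :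
    aeval v (quadPoly τ a) x = v (v x) + τ • v x + a • x := by
  simp [quadPoly, pow_two, Module.algebraMap_end_apply]

theorem neg_eq_self_of_charTwo [CharP F 2] (x : V) : -x = x := by
  rw [← neg_one_smul F x, CharTwo.neg_eq, one_smul]

theorem aeval_quadPoly_eq_zero_iff [CharP F 2] (τ a : F) (v : Module.End F V) :
    aeval v (quadPoly τ a) = 0 ↔ ∀ x, v (v x) = τ • v x + a • x := by
  rw [LinearMap.ext_iff]
  refine forall_congr' fun x => ?_
  rw [aeval_quadPoly_apply, LinearMap.zero_apply, add_assoc, add_eq_zero_iff_eq_neg,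
    neg_eq_self_of_charTwo (F := F)]

/-- The partner is v = u₁. Expanding q(v - u) = 0 and eliminating v² by p(v) = 0 leaves exactly the
relation on vu + uv. -/
theorem isSymplecticDifference_quadPoly_iff [CharP F 2] {τ a c : F}
    {b : LinearMap.BilinForm F V} {u : Module.End F V} (hbu : IsSymplecticPair b u) :
    IsSymplecticDifference (quadPoly τ a) (quadPoly τ c) b u ↔ HasPartner τ a (a + c) b u := by
  have h2 : (2 : F) = 0 := CharTwo.two_eq_zero
  have htwo : ∀ x : V, (2 : F) • x = 0 := fun x => by rw [h2, zero_smul]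
  constructor
  · rintro ⟨-, v, w, hv, -, hpv, hqw, hu⟩
    rw [aeval_quadPoly_eq_zero_iff] at hpv hqw
    refine ⟨v, hv, hpv, fun x => ?_⟩
    obtain rfl : w = v - u := by rw [hu]; abel
    have h3 := hqw x
    simp only [LinearMap.sub_apply, map_sub] at h3
    linear_combination (norm := module) (-1 : F) • h3 + hpv x - htwo (c • x)
  · rintro ⟨v, hv, hpv, hvu⟩
    refine ⟨hbu, v, v - u, hv, fun x => ?_, (aeval_quadPoly_eq_zero_iff _ _ _).2 hpv,
      (aeval_quadPoly_eq_zero_iff _ _ _).2 fun x => ?_, by abel⟩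
    · rw [LinearMap.sub_apply, map_sub, hv, hbu.alternating, sub_zero]
    · simp only [LinearMap.sub_apply, map_sub]
      linear_combination (norm := module) hpv x - hvu x - htwo (c • x)

end Partner

/-! ### Divisibility of dimensions by the degree of a field acting on the space. -/

section Dimension

variable {K E : Type*} [Field K] [AddCommGroup E] [Module K E]

/-- An endomorphism annihilated by `f` makes the space a module over `K[X] / (f)`. -/
noncomputable abbrev adjoinRootModule {f : K[X]} {v : Module.End K E} (h : aeval v f = 0) :
    Module (AdjoinRoot f) E :=
  Module.compHom E (Ideal.Quotient.lift (Ideal.span {f}) (aeval v : K[X] →ₐ[K] _).toRingHom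
    (by
      intro g hg
      obtain ⟨g, rfl⟩ := Ideal.mem_span_singleton.1 hg
      change aeval v (f * g) = 0
      rw [map_mul, h, zero_mul]))

theorem adjoinRootModule_mk_smul {f : K[X]} {v : Module.End K E} (h : aeval v f = 0)
    (g : K[X]) (x : E) :
    (letI := adjoinRootModule h; AdjoinRoot.mk f g • x) = aeval v g x := rfl

theorem adjoinRootModule_isScalarTower {f : K[X]} {v : Module.End K E} (h : aeval v f = 0) :
    letI := adjoinRootModule h
    IsScalarTower K (AdjoinRoot f) E := by
  let := adjoinRootModule h
  refine IsScalarTower.of_algebraMap_smul fun r x => ?_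
  change AdjoinRoot.mk f (C r) • x = r • x
  rw [adjoinRootModule_mk_smul h, aeval_C, Module.algebraMap_end_apply]

theorem finrank_eq_natDegree_mul {f : K[X]} [Fact (Irreducible f)]
    {v : Module.End K E} (h : aeval v f = 0) :
    letI := adjoinRootModule h
    Module.finrank K E = f.natDegree * Module.finrank (AdjoinRoot f) E := by
  let := adjoinRootModule h
  have := adjoinRootModule_isScalarTower h
  rw [← Module.finrank_mul_finrank K (AdjoinRoot f) E]
  congr 1
  exact finrank_quotient_span_eq_natDegree

theorem natDegree_dvd_finrank {f : K[X]} (hf : Irreducible f) {v : Module.End K E}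
    (h : aeval v f = 0) : f.natDegree ∣ Module.finrank K E := by
  have := Fact.mk hf
  exact ⟨_, finrank_eq_natDegree_mul h⟩

/-- Since v commutes with u, it is linear over the quadratic field generated by u. There its
annihilating polynomial is still irreducible, which yields a second factor 2. -/
theorem four_dvd_finrank {τ a e : K} [Fact (Irreducible (quadPoly τ e))]
    (hp : Irreducible (quadPoly (AdjoinRoot.of (quadPoly τ e) τ) (AdjoinRoot.of (quadPoly τ e) a)))
    {u v : Module.End K E} (hu : aeval u (quadPoly τ e) = 0)
    (hv : ∀ x, v (v x) + τ • v x + a • x = 0) (huv : ∀ x, v (u x) = u (v x)) :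
    4 ∣ Module.finrank K E := by
  rw [finrank_eq_natDegree_mul hu, quadPoly_natDegree]
  let := adjoinRootModule hu
  have hcomm : ∀ (g : K[X]) x, v (aeval u g x) = aeval u g (v x) := by
    intro g x
    have h1 : Commute v u := LinearMap.ext huv
    have h2 : Commute v (aeval u g) := by
      induction g using Polynomial.induction_on' with
      | add f g hf hg => rw [map_add]; exact hf.add_right hg
      | monomial n r =>
        rw [aeval_monomial]
        exact (Algebra.commute_algebraMap_right r v).mul_right (h1.pow_right n)
    exact LinearMap.congr_fun h2 x
  let v' : Module.End (AdjoinRoot (quadPoly τ e)) E :=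
    { toFun := v
      map_add' := map_add v
      map_smul' := by
        intro r x
        obtain ⟨g, rfl⟩ := AdjoinRoot.mk_surjective r
        exact hcomm g x }
  have h1 : aeval v' (quadPoly (AdjoinRoot.of (quadPoly τ e) τ)
      (AdjoinRoot.of (quadPoly τ e) a)) = 0 := by
    refine LinearMap.ext fun x => ?_
    rw [aeval_quadPoly_apply, LinearMap.zero_apply, ← hv x]
    have := adjoinRootModule_isScalarTower hu
    change v (v x) + algebraMap K (AdjoinRoot (quadPoly τ e)) τ • v x +
      algebraMap K (AdjoinRoot (quadPoly τ e)) a • x = _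
    rw [algebraMap_smul, algebraMap_smul]
  have h2 := natDegree_dvd_finrank hp h1
  rw [quadPoly_natDegree] at h2
  exact mul_dvd_mul_left 2 h2

end Dimension

/-! ### Lagrangians stable under two commuting self-adjoint quadratic operators. -/

section Lagrangian

variable {F E : Type*} [Field F] [AddCommGroup E] [Module F E]

theorem IsAlternatingFor.apply_comm {b : LinearMap.BilinForm F E} (hb : b.IsAlt)
    {u : Module.End F E} (hu : IsAlternatingFor b u) (x y : E) : b (u x) y = b x (u y) := by
  have h1 := hu (x + y)
  simp only [map_add, LinearMap.add_apply, hu x, hu y, zero_add, add_zero] at h1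
  rw [← hb.neg_eq]
  exact neg_eq_of_add_eq_zero_right h1

/-- A self-adjoint quadratic algebra acting on an alternating space makes every cyclic subspace
isotropic. -/
theorem apply_mul_eq_zero [CharP F 2] {b : LinearMap.BilinForm F E} (hb : b.IsAlt) {τ a : F}
    (hτ : τ ≠ 0) {v : Module.End F E} (hv : ∀ x, v (v x) + τ • v x + a • x = 0)
    (hsv : ∀ x y, b (v x) y = b x (v y)) (x : E) : b x (v x) = 0 := by
  have h1 : b x (v (v x)) = 0 := by rw [← hsv]; exact hb _
  have h2 : b x (v (v x) + τ • v x + a • x) = 0 := by rw [hv, map_zero]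
  simpa [h1, hb x, hτ] using h2

/-- Every cyclic submodule span(x, ux, vx, uvx) is totally isotropic. Hence a maximal invariant
isotropic subspace S is its own orthogonal, so dim E = 2 dim S, and 4 divides dim S by
`four_dvd_finrank`. -/
theorem eight_dvd_finrank_of_nondegenerate [CharP F 2] [FiniteDimensional F E] {τ a e : F}
    (hτ : τ ≠ 0) [Fact (Irreducible (quadPoly τ e))]
    (hp : Irreducible (quadPoly (AdjoinRoot.of (quadPoly τ e) τ) (AdjoinRoot.of (quadPoly τ e) a)))
    {b : LinearMap.BilinForm F E} (hb : b.IsAlt) (hnd : b.Nondegenerate) {u v : Module.End F E}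
    (hu : ∀ x, u (u x) + τ • u x + e • x = 0)
    (hv : ∀ x, v (v x) + τ • v x + a • x = 0) (huv : ∀ x, v (u x) = u (v x))
    (hsu : ∀ x y, b (u x) y = b x (u y)) (hsv : ∀ x y, b (v x) y = b x (v y)) :
    8 ∣ Module.finrank F E := by
  have hbu := apply_mul_eq_zero hb hτ hu hsu
  have hbv := apply_mul_eq_zero hb hτ hv hsv
  have h2 : ∀ y, u (u y) = -(τ • u y + e • y) := fun y => by
      rw [← add_eq_zero_iff_eq_neg, ← add_assoc]; exact hu y
  have h3 : ∀ y, v (v y) = -(τ • v y + a • y) := fun y => by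
      rw [← add_eq_zero_iff_eq_neg, ← add_assoc]; exact hv y
  have hbuv : ∀ x, b x (u (v x)) = 0 := by
    intro x
    -- Moving u and v to the right and reducing u² and v² leaves only τ² b(x, uvx), all other terms
    -- being known to vanish.
    have h1 : b (u (v x)) (u (v x)) = 0 := hb _
    rw [hsu, h2, ← huv, hsv] at h1
    simp only [map_neg, map_add, map_smul, h3, hbu x, hbv x, hb x, add_zero, huv,
      smul_eq_mul, mul_zero] at h1
    simpa [hτ] using h1
  obtain ⟨S, ⟨hS1, hS2, hS3⟩, hmax⟩ : ∃ S : Submodule F E,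
      Maximal (fun S : Submodule F E => (∀ x ∈ S, u x ∈ S) ∧ (∀ x ∈ S, v x ∈ S) ∧
        S ≤ b.orthogonal S) S :=
    exists_maximal_of_wellFoundedGT _ ⟨⊥, by simp⟩
  have hSo : b.orthogonal S = S := by
    refine le_antisymm (fun x hx => ?_) hS3
    -- For x orthogonal to S, the sum S ⊔ X is again invariant and isotropic, so maximality puts x
    -- in S.
    let X : Submodule F E := Submodule.span F {x, u x, v x, u (v x)}
    have hx' : ∀ y ∈ S, b y x = 0 := hx
    have hX1 : ∀ y ∈ X, u y ∈ X := by
      have h : X ≤ X.comap u := by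
        refine Submodule.span_le.2 ?_
        have m1 : x ∈ X := Submodule.subset_span (by simp)
        have m2 : u x ∈ X := Submodule.subset_span (by simp)
        have m3 : v x ∈ X := Submodule.subset_span (by simp)
        have m4 : u (v x) ∈ X := Submodule.subset_span (by simp)
        rintro y (rfl | rfl | rfl | rfl)
        · exact m2
        · change u (u x) ∈ X
          rw [h2]
          exact X.neg_mem (X.add_mem (X.smul_mem _ m2) (X.smul_mem _ m1))
        · exact m4
        · change u (u (v x)) ∈ X
          rw [h2]
          exact X.neg_mem (X.add_mem (X.smul_mem _ m4) (X.smul_mem _ m3))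
      exact h
    have hX2 : ∀ y ∈ X, v y ∈ X := by
      have h : X ≤ X.comap v := by
        refine Submodule.span_le.2 ?_
        have m1 : x ∈ X := Submodule.subset_span (by simp)
        have m2 : u x ∈ X := Submodule.subset_span (by simp)
        have m3 : v x ∈ X := Submodule.subset_span (by simp)
        have m4 : u (v x) ∈ X := Submodule.subset_span (by simp)
        rintro y (rfl | rfl | rfl | rfl)
        · exact m3
        · change v (u x) ∈ X
          rwa [huv]
        · change v (v x) ∈ X
          rw [h3]
          exact X.neg_mem (X.add_mem (X.smul_mem _ m3) (X.smul_mem _ m1))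
        · change v (u (v x)) ∈ X
          rw [huv, h3, map_neg, map_add, map_smul, map_smul]
          exact X.neg_mem (X.add_mem (X.smul_mem _ m4) (X.smul_mem _ m2))
      exact h
    have hSX : X ≤ b.orthogonal S := by
      refine Submodule.span_le.2 ?_
      rintro y (rfl | rfl | rfl | rfl) z hz
      · exact hx' z hz
      · exact (hsu z x).symm.trans (hx' _ (hS1 z hz))
      · exact (hsv z x).symm.trans (hx' _ (hS2 z hz))
      · exact ((hsu _ _).symm.trans (hsv _ _).symm).trans (hx' _ (hS2 _ (hS1 z hz)))
    have hXS : S ≤ b.orthogonal X := fun y hy z hz => hb.isRefl y z (hSX hz y hy)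
    have hXX : X ≤ b.orthogonal X := by
      refine Submodule.span_le.2 fun y hy z hz => ?_
      have h : X ≤ LinearMap.ker (b.flip y) := by
        refine Submodule.span_le.2 fun z hz => ?_
        change b z y = 0
        simp only [Set.mem_insert_iff, Set.mem_singleton_iff] at hy hz
        have hb' : ∀ y, b y y = 0 := hb
        rcases hy with hy | hy | hy | hy <;> rcases hz with hz | hz | hz | hz <;>
          simp [hy, hz, hsu, hsv, h2, h3, huv, hbu, hbv, hbuv, hb']
      exact h hz
    have hT := @hmax (S ⊔ X) ⟨?_, ?_, ?_⟩ le_sup_left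
    · exact hT (Submodule.mem_sup_right (Submodule.subset_span (by simp)))
    · intro y hy
      obtain ⟨s, hs, z, hz, rfl⟩ := Submodule.mem_sup.1 hy
      rw [map_add]
      exact Submodule.add_mem_sup (hS1 s hs) (hX1 z hz)
    · intro y hy
      obtain ⟨s, hs, z, hz, rfl⟩ := Submodule.mem_sup.1 hy
      rw [map_add]
      exact Submodule.add_mem_sup (hS2 s hs) (hX2 z hz)
    · have h : ∀ Y : Submodule F E, S ≤ b.orthogonal Y → X ≤ b.orthogonal Y →
          S ⊔ X ≤ b.orthogonal Y := fun Y => sup_le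
      intro y hy z hz
      obtain ⟨s, hs, w, hw, rfl⟩ := Submodule.mem_sup.1 hz
      have e1 : b s y = 0 := h S hS3 hSX hy s hs
      have e2 : b w y = 0 := h X hXS hXX hy w hw
      change b (s + w) y = 0
      rw [map_add, LinearMap.add_apply, e1, e2, add_zero]
  have h1 := LinearMap.BilinForm.finrank_orthogonal hnd S
  have h2 := Submodule.finrank_le S
  rw [hSo] at h1
  have h3 : 4 ∣ Module.finrank F S := by
    refine four_dvd_finrank hp (u := u.restrict hS1) (v := v.restrict hS2) ?_ ?_ ?_
    · refine LinearMap.ext fun x => ?_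
      rw [aeval_quadPoly_apply]
      exact Subtype.ext (hu x)
    · exact fun x => Subtype.ext (hv x)
    · exact fun x => Subtype.ext (huv x)
  omega

/-- The relations are needed only modulo the radical. Self-adjointness makes the radical stable
under u and v, so everything descends to the nondegenerate quotient. -/
theorem eight_dvd_finrank_quotient_ker [CharP F 2] [FiniteDimensional F E] {τ a e : F}
    (hτ : τ ≠ 0) [Fact (Irreducible (quadPoly τ e))]
    (hp : Irreducible (quadPoly (AdjoinRoot.of (quadPoly τ e) τ) (AdjoinRoot.of (quadPoly τ e) a)))
    {b : LinearMap.BilinForm F E} (hb : b.IsAlt) {u v : Module.End F E}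
    (hu : ∀ x, u (u x) + τ • u x + e • x ∈ LinearMap.ker b)
    (hv : ∀ x, v (v x) + τ • v x + a • x ∈ LinearMap.ker b)
    (huv : ∀ x, v (u x) - u (v x) ∈ LinearMap.ker b)
    (hsu : ∀ x y, b (u x) y = b x (u y)) (hsv : ∀ x y, b (v x) y = b x (v y)) :
    8 ∣ Module.finrank F (E ⧸ LinearMap.ker b) := by
  set P := LinearMap.ker b with hP
  have hmem : ∀ x, x ∈ P ↔ ∀ y, b x y = 0 := fun x => by
    rw [hP, LinearMap.mem_ker, LinearMap.ext_iff]; rfl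
  have hmem' : ∀ x, x ∈ P ↔ ∀ y, b y x = 0 := fun x => by
    rw [hmem]
    exact forall_congr' fun y => ⟨hb.isRefl x y, hb.isRefl y x⟩
  have huP : P ≤ P.comap u := fun x hx => by
    rw [Submodule.mem_comap, hmem]
    intro y
    rw [hsu]
    exact (hmem x).1 hx _
  have hvP : P ≤ P.comap v := fun x hx => by
    rw [Submodule.mem_comap, hmem]
    intro y
    rw [hsv]
    exact (hmem x).1 hx _
  let B₁ : (E ⧸ P) →ₗ[F] E →ₗ[F] F := P.liftQ b le_rfl
  let B : LinearMap.BilinForm F (E ⧸ P) := P.liftQ B₁.flip (by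
    intro x hx
    rw [LinearMap.mem_ker]
    refine LinearMap.ext fun y => ?_
    obtain ⟨y, rfl⟩ := P.mkQ_surjective y
    exact (hmem' x).1 hx y)
  have hB : ∀ x y, B (P.mkQ x) (P.mkQ y) = b y x := fun x y => rfl
  refine eight_dvd_finrank_of_nondegenerate hτ hp (b := B) (u := P.mapQ P u huP)
    (v := P.mapQ P v hvP) ?_ ?_ ?_ ?_ ?_ ?_ ?_
  · intro x
    obtain ⟨x, rfl⟩ := P.mkQ_surjective x
    rw [hB]
    exact hb x
  · constructor
    · intro x hx
      obtain ⟨x, rfl⟩ := P.mkQ_surjective x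
      rw [Submodule.mkQ_apply, Submodule.Quotient.mk_eq_zero, hmem']
      exact fun y => hx (P.mkQ y)
    · intro x hx
      obtain ⟨x, rfl⟩ := P.mkQ_surjective x
      rw [Submodule.mkQ_apply, Submodule.Quotient.mk_eq_zero, hmem]
      exact fun y => hx (P.mkQ y)
  · intro x
    obtain ⟨x, rfl⟩ := P.mkQ_surjective x
    exact (Submodule.Quotient.mk_eq_zero _).2 (hu x)
  · intro x
    obtain ⟨x, rfl⟩ := P.mkQ_surjective x
    exact (Submodule.Quotient.mk_eq_zero _).2 (hv x)
  · intro x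
    obtain ⟨x, rfl⟩ := P.mkQ_surjective x
    exact (Submodule.Quotient.eq _).2 (huv x)
  · intro x y
    obtain ⟨x, rfl⟩ := P.mkQ_surjective x
    obtain ⟨y, rfl⟩ := P.mkQ_surjective y
    exact (hsu y x).symm
  · intro x y
    obtain ⟨x, rfl⟩ := P.mkQ_surjective x
    obtain ⟨y, rfl⟩ := P.mkQ_surjective y
    exact (hsv y x).symm

end Lagrangian

/-! ### Kernel dimensions of powers of d(u), and the necessary condition. -/

section KernelDimension

variable {F V : Type*} [Field F] [AddCommGroup V] [Module F V]

/-- The dimension of the kernel of `f ^ j`. -/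
noncomputable def kerPowDim (f : Module.End F V) (j : ℕ) : ℕ :=
  Module.finrank F (LinearMap.ker (f ^ j))

/-- The opposite of the second difference of `kerPowDim f`, centered at `j + 1`: the number of
nilpotent Jordan blocks of `f` of size exactly `j + 1`. -/
noncomputable def blockDim (f : Module.End F V) (j : ℕ) : ℤ :=
  2 * kerPowDim f (j + 1) - kerPowDim f j - kerPowDim f (j + 2)

theorem finrank_map_add_finrank_ker_inf [FiniteDimensional F V] {W : Type*} [AddCommGroup W]
    [Module F W] (f : V →ₗ[F] W) (S : Submodule F V) :
    Module.finrank F (S.map f) + Module.finrank F (LinearMap.ker f ⊓ S : Submodule F V) =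
      Module.finrank F S := by
  rw [← LinearMap.finrank_range_add_finrank_ker (f.domRestrict S), LinearMap.range_domRestrict,
    LinearMap.ker_domRestrict, ← Submodule.finrank_map_subtype_eq, Submodule.map_comap_subtype,
    inf_comm]

theorem range_eq_orthogonal_ker [FiniteDimensional F V] {b : LinearMap.BilinForm F V}
    (hnd : b.Nondegenerate) {f : Module.End F V}
    (hf : ∀ x y, b (f x) y = b x (f y)) : LinearMap.range f = b.orthogonal (LinearMap.ker f) := by
  refine Submodule.eq_of_le_of_finrank_eq ?_ ?_
  · rintro _ ⟨x, rfl⟩ y hy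
    change b y (f x) = 0
    rw [← hf, LinearMap.mem_ker.1 hy, map_zero, LinearMap.zero_apply]
  · rw [LinearMap.BilinForm.finrank_orthogonal hnd, ← f.finrank_range_add_finrank_ker]
    omega

theorem apply_pow_comm {b : LinearMap.BilinForm F V} {f : Module.End F V}
    (hf : ∀ x y, b (f x) y = b x (f y)) (n : ℕ) (x y : V) :
    b ((f ^ n) x) y = b x ((f ^ n) y) := by
  induction n generalizing x y with
  | zero => rfl
  | succ n ih => rw [pow_succ, Module.End.mul_apply, ih, hf, ← Module.End.mul_apply,
      ← pow_succ', pow_succ]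

/-- The number `blockDim` is realised as the dimension of Ker D^(2m+1) modulo the radical of b(x,
D^(2m) y), a space to which `eight_dvd_finrank_quotient_ker` applies. -/
theorem HasPartner.eight_dvd_blockDim [CharP F 2] [FiniteDimensional F V] {τ a e : F}
    (hτ : τ ≠ 0) [Fact (Irreducible (quadPoly τ e))]
    (hp : Irreducible (quadPoly (AdjoinRoot.of (quadPoly τ e) τ) (AdjoinRoot.of (quadPoly τ e) a)))
    {b : LinearMap.BilinForm F V} {u : Module.End F V} (hbu : IsSymplecticPair b u)
    (h : HasPartner τ a e b u) (m : ℕ) :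
    8 ∣ blockDim (aeval u (quadPoly τ e)) (2 * m) := by
  have htwo : ∀ x : V, (2 : F) • x = 0 := fun x => by rw [CharTwo.two_eq_zero, zero_smul]
  obtain ⟨v, hv, hvv, hvu⟩ := h
  set D := aeval u (quadPoly τ e) with hD
  have hDx : ∀ x, D x = u (u x) + τ • u x + e • x := fun x => aeval_quadPoly_apply _ _ _ _
  have hsu := hbu.alternating.apply_comm hbu.isAlt
  have hsv := hv.apply_comm hbu.isAlt
  have hsD : ∀ x y, b (D x) y = b x (D y) := fun x y => by
    simp [hDx, hsu]
  have hDu : ∀ x, D (u x) = u (D x) := fun x => by simp [hDx]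
  -- From [v, u] = D one gets [v, u² + τu] = Du + uD + τD = τD, as D commutes with u and 2 = 0.
  have hDv : ∀ x, v (D x) = D (v x) + τ • D x := fun x => by
    have h1 := hvu (u x)
    have h2 := congrArg u (hvu x)
    have h3 := hvu x
    simp only [hDx, map_add, map_smul] at h1 h2 ⊢
    linear_combination (norm := module) h1 - h2 + τ • h3 - htwo (τ • u (v x))
  have hDDv : ∀ n x, v ((D ^ (2 * n)) x) = (D ^ (2 * n)) (v x) := by
    intro n x
    induction n with
    | zero => rfl
    | succ n ih =>
      have e1 : ∀ y, (D ^ (2 * (n + 1))) y = D (D ((D ^ (2 * n)) y)) := fun y => by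
        rw [show 2 * (n + 1) = 2 * n + 1 + 1 by ring, pow_succ', pow_succ']; rfl
      rw [e1, e1, hDv, hDv, ih, map_add, map_smul]
      linear_combination (norm := module) htwo (τ • D (D ((D ^ (2 * n)) x)))
  have hDuPow : ∀ n x, (D ^ n) (u x) = u ((D ^ n) x) := fun n x => by
    have h1 : Commute D u := LinearMap.ext hDu
    exact LinearMap.congr_fun (h1.pow_left n) x
  have hDsucc : ∀ n x, (D ^ (n + 1)) x = D ((D ^ n) x) := fun n x => by rw [pow_succ']; rfl
  have hDadd : ∀ n k x, (D ^ (n + k)) x = (D ^ n) ((D ^ k) x) := fun n k x => by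
    rw [pow_add]; rfl
  set Q := LinearMap.ker (D ^ (2 * m + 1)) with hQ
  have hQu : ∀ x ∈ Q, u x ∈ Q := fun x hx => by
    rw [hQ, LinearMap.mem_ker] at hx ⊢
    rw [hDuPow, hx, map_zero]
  have hQv : ∀ x ∈ Q, v x ∈ Q := fun x hx => by
    rw [hQ, LinearMap.mem_ker, hDsucc] at hx ⊢
    have := hDv ((D ^ (2 * m)) x)
    rw [hx, smul_zero, add_zero, map_zero, hDDv] at this
    exact this.symm
  -- The even power serves twice: c(x, x) = b(D^m x, D^m x) = 0, and v commutes with D^(2m), hence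
  -- is self-adjoint for c.
  let c : LinearMap.BilinForm F Q := b.compl₁₂ Q.subtype ((D ^ (2 * m)) ∘ₗ Q.subtype)
  have hc : ∀ x y : Q, c x y = b x ((D ^ (2 * m)) y) := fun x y => rfl
  have hker : (LinearMap.ker c).map Q.subtype =
      Q ⊓ (LinearMap.range (D ^ (2 * m + 1))).comap (D ^ (2 * m)) := by
    ext x
    rw [Submodule.mem_map, Submodule.mem_inf, Submodule.mem_comap,
      range_eq_orthogonal_ker hbu.nondegenerate (apply_pow_comm hsD _)]
    constructor
    · rintro ⟨x, hx, rfl⟩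
      refine ⟨x.2, fun y hy => ?_⟩
      have := LinearMap.congr_fun (LinearMap.mem_ker.1 hx) ⟨y, hy⟩
      rw [hc, LinearMap.zero_apply, ← apply_pow_comm hsD] at this
      exact hbu.isAlt.isRefl _ _ this
    · rintro ⟨hx, hx'⟩
      refine ⟨⟨x, hx⟩, LinearMap.mem_ker.2 (LinearMap.ext fun y => ?_), rfl⟩
      rw [hc, LinearMap.zero_apply, ← apply_pow_comm hsD]
      exact hbu.isAlt.isRefl _ _ (hx' y y.2)
  have h8 : 8 ∣ Module.finrank F (Q ⧸ LinearMap.ker c) := by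
    have hDker : ∀ x (hx : x ∈ Q), ∀ y : Q, ∀ hy : (y : V) = D x, y ∈ LinearMap.ker c := by
      intro x hx y hy
      refine LinearMap.mem_ker.2 (LinearMap.ext fun z => ?_)
      rw [hc, LinearMap.zero_apply, hy, hsD, ← hDsucc, LinearMap.mem_ker.1 z.2, map_zero]
    refine eight_dvd_finrank_quotient_ker hτ hp (b := c) (u := u.restrict hQu)
      (v := v.restrict hQv) ?_ ?_ ?_ ?_ ?_ ?_
    · intro x
      rw [hc, two_mul, hDadd, ← apply_pow_comm hsD]
      exact hbu.isAlt _
    · exact fun x => hDker x x.2 _ (hDx x).symm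
    · intro x
      convert (LinearMap.ker c).zero_mem
      refine Subtype.ext ?_
      change v (v x) + τ • v x + a • (x : V) = 0
      rw [hvv]
      linear_combination (norm := module) htwo (τ • v x) + htwo (a • (x : V))
    · intro x
      refine hDker x x.2 _ ?_
      change v (u x) - u (v x) = D x
      rw [hDx, ← hvu]
      linear_combination (norm := module) - htwo (u (v x))
    · intro x y
      change b (u x) ((D ^ (2 * m)) y) = b x ((D ^ (2 * m)) (u y))
      rw [hsu, hDuPow]
    · intro x y
      change b (v x) ((D ^ (2 * m)) y) = b x ((D ^ (2 * m)) (v y))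
      rw [hsv, hDDv]
  -- Write k_i = dim Ker D^i. By `hmap`, D^(2m) sends the radical onto a space of dimension k_(2m+2)
  -- - k_(2m+1), with kernel Ker D^(2m). The radical thus has dimension k_(2m+2) - k_(2m+1) +
  -- k_(2m), and the quotient has dimension `blockDim`.
  have hdim1 := Submodule.finrank_quotient_add_finrank (LinearMap.ker c)
  rw [← Submodule.finrank_map_subtype_eq, hker] at hdim1
  have hdim2 := finrank_map_add_finrank_ker_inf (D ^ (2 * m))
    (Q ⊓ (LinearMap.range (D ^ (2 * m + 1))).comap (D ^ (2 * m)))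
  have hdim3 := finrank_map_add_finrank_ker_inf (D ^ (2 * m + 1))
    (LinearMap.ker (D ^ (2 * m + 2)))
  have hle1 : LinearMap.ker (D ^ (2 * m)) ⊓
      (Q ⊓ (LinearMap.range (D ^ (2 * m + 1))).comap (D ^ (2 * m))) =
      LinearMap.ker (D ^ (2 * m)) := by
    refine inf_eq_left.2 fun x hx => ?_
    rw [LinearMap.mem_ker] at hx
    refine ⟨?_, ?_⟩
    · change (D ^ (2 * m + 1)) x = 0
      rw [hDsucc, hx, map_zero]
    · rw [SetLike.mem_coe, Submodule.mem_comap, hx]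
      exact Submodule.zero_mem _
  have hle2 : LinearMap.ker (D ^ (2 * m + 1)) ⊓ LinearMap.ker (D ^ (2 * m + 2)) =
      LinearMap.ker (D ^ (2 * m + 1)) := by
    refine inf_eq_left.2 fun x hx => ?_
    rw [LinearMap.mem_ker] at hx ⊢
    rw [hDsucc, hx, map_zero]
  have hmap : (Q ⊓ (LinearMap.range (D ^ (2 * m + 1))).comap (D ^ (2 * m))).map (D ^ (2 * m)) =
      (LinearMap.ker (D ^ (2 * m + 2))).map (D ^ (2 * m + 1)) := by
    ext y
    constructor
    · rintro ⟨x, ⟨hx, z, hz⟩, rfl⟩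
      refine ⟨z, ?_, hz⟩
      change (D ^ (2 * m + 2)) z = 0
      rw [hDsucc, hz, ← hDsucc]
      exact hx
    · rintro ⟨x, hx, rfl⟩
      refine ⟨D x, ⟨?_, x, ?_⟩, ?_⟩
      · change (D ^ (2 * m + 1)) (D x) = 0
        rw [← Module.End.mul_apply, ← pow_succ]
        exact hx
      · rw [pow_succ]; rfl
      · rw [pow_succ]; rfl
  rw [hle1, hmap] at hdim2
  rw [hle2] at hdim3
  unfold blockDim kerPowDim
  rw [← hQ] at *
  omega

end KernelDimension

/-! ### Kernel dimensions under isomorphisms and direct sums. -/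

section KernelDimensionFunctoriality

variable {F V W : Type*} [Field F] [AddCommGroup V] [Module F V] [AddCommGroup W] [Module F W]

theorem kerPowDim_congr (e : V ≃ₗ[F] W) {f : Module.End F V} {g : Module.End F W}
    (h : ∀ x, e (f x) = g (e x)) (j : ℕ) : kerPowDim f j = kerPowDim g j := by
  have hpow : ∀ x, e ((f ^ j) x) = (g ^ j) (e x) := by
    induction j with
    | zero => exact fun x => rfl
    | succ j ih => intro x; rw [pow_succ, pow_succ, Module.End.mul_apply, ih, h]; rfl
  unfold kerPowDim
  have h1 : (LinearMap.ker (f ^ j)).map (e : V →ₗ[F] W) = LinearMap.ker (g ^ j) := by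
    ext y
    constructor
    · rintro ⟨x, hx, rfl⟩
      change (g ^ j) (e x) = 0
      rw [← hpow, LinearMap.mem_ker.1 hx, map_zero]
    · intro hy
      refine ⟨e.symm y, ?_, e.apply_symm_apply y⟩
      change (f ^ j) (e.symm y) = 0
      apply e.injective
      rw [hpow, e.apply_symm_apply, map_zero]
      exact hy
  rw [← h1]
  exact (LinearEquiv.finrank_map_eq e _).symm

theorem kerPowDim_prodMap [FiniteDimensional F V] [FiniteDimensional F W] (f : Module.End F V)
    (g : Module.End F W) (j : ℕ) :
    kerPowDim (LinearMap.prodMap f g) j = kerPowDim f j + kerPowDim g j := by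
  have hpow : (LinearMap.prodMap f g) ^ j = LinearMap.prodMap (f ^ j) (g ^ j) := by
    induction j with
    | zero => rfl
    | succ j ih => rw [pow_succ, ih, pow_succ, pow_succ]; rfl
  unfold kerPowDim
  rw [hpow, LinearMap.ker_prodMap, ← Module.finrank_prod]
  exact LinearEquiv.finrank_eq
    { toFun := fun x => (⟨x.1.1, x.2.1⟩, ⟨x.1.2, x.2.2⟩)
      invFun := fun x => ⟨(x.1, x.2), x.1.2, x.2.2⟩
      map_add' := fun x y => rfl
      map_smul' := fun r x => rfl
      left_inv := fun x => rfl
      right_inv := fun x => rfl }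

theorem kerPowDim_pi {ι : Type*} [Fintype ι] {M : ι → Type*} [∀ i, AddCommGroup (M i)]
    [∀ i, Module F (M i)] [∀ i, FiniteDimensional F (M i)] (f : ∀ i, Module.End F (M i)) (j : ℕ) :
    kerPowDim (LinearMap.pi fun i => f i ∘ₗ LinearMap.proj i) j = ∑ i, kerPowDim (f i) j := by
  have hpow : ∀ x i, ((LinearMap.pi fun i => f i ∘ₗ LinearMap.proj i : Module.End F (∀ i, M i)) ^ j)
      x i = (f i ^ j) (x i) := by
    induction j with
    | zero => exact fun x i => rfl
    | succ j ih => intro x i; rw [pow_succ, pow_succ, Module.End.mul_apply, ih]; rfl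
  unfold kerPowDim
  rw [← Module.finrank_pi_fintype]
  refine LinearEquiv.finrank_eq
    { toFun := fun x i => ⟨x.1 i, ?_⟩
      invFun := fun x => ⟨fun i => x i, ?_⟩
      map_add' := fun x y => rfl
      map_smul' := fun r x => rfl
      left_inv := fun x => rfl
      right_inv := fun x => rfl }
  · rw [LinearMap.mem_ker, ← hpow, LinearMap.mem_ker.1 x.2]; rfl
  · rw [LinearMap.mem_ker]
    refine funext fun i => ?_
    rw [hpow]
    exact (x i).2

theorem kerPowDim_of_pow_eq_zero {f : Module.End F V} {j : ℕ} (h : f ^ j = 0) :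
    kerPowDim f j = Module.finrank F V := by
  rw [kerPowDim, h, LinearMap.ker_zero, finrank_top]

end KernelDimensionFunctoriality

/-! ### Kernel dimensions on a cyclic module. -/

section QuotientRing

variable {F : Type*} [Field F]

theorem finiteDimensional_quotient_span {g : F[X]} (hg : g ≠ 0) :
    FiniteDimensional F (F[X] ⧸ Ideal.span {g}) :=
  (AdjoinRoot.powerBasis hg).finite

/-- For j ≤ k, the image of multiplication by d^j is the kernel of the reduction modulo d^j, so its
kernel has the dimension of F[t]/(d^j). For j ≥ k the multiplication is zero. -/
theorem kerPowDim_lmul_quotient {d g : F[X]} (hd : d ≠ 0) {k : ℕ} (hg : g = d ^ k) (j : ℕ) :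
    kerPowDim (Algebra.lmul F (F[X] ⧸ Ideal.span {g}) (Ideal.Quotient.mk _ d)) j =
      d.natDegree * min j k := by
  have hg0 : g ≠ 0 := hg ▸ pow_ne_zero k hd
  have := finiteDimensional_quotient_span hg0
  rcases le_total k j with hkj | hjk
  · rw [kerPowDim_of_pow_eq_zero, finrank_quotient_span_eq_natDegree, hg, natDegree_pow,
      min_eq_right hkj, mul_comm]
    rw [← map_pow, ← map_pow, Ideal.Quotient.eq_zero_iff_mem.2, map_zero]
    exact Ideal.mem_span_singleton.2 (hg ▸ pow_dvd_pow d hkj)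
  · have hle : Ideal.span {g} ≤ Ideal.span {d ^ j} :=
      Ideal.span_singleton_le_span_singleton.2 (hg ▸ pow_dvd_pow d hjk)
    let ψ := (Ideal.Quotient.factorₐ F hle).toLinearMap
    have hψ : Function.Surjective ψ := Ideal.Quotient.factor_surjective hle
    let μ := Algebra.lmul F (F[X] ⧸ Ideal.span {g}) (Ideal.Quotient.mk _ d) ^ j
    have hμ : ∀ f : F[X], μ (Ideal.Quotient.mk _ f) = Ideal.Quotient.mk _ (d ^ j * f) := by
      intro f
      simp only [μ, ← map_pow]
      exact (map_mul _ _ _).symm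
    have hker : LinearMap.ker ψ = LinearMap.range μ := by
      ext x
      obtain ⟨f, rfl⟩ := Ideal.Quotient.mk_surjective x
      have h1 : Ideal.Quotient.mk (Ideal.span {g}) f ∈ LinearMap.ker ψ ↔ d ^ j ∣ f := by
        rw [← Ideal.mem_span_singleton, ← Ideal.Quotient.eq_zero_iff_mem]
        rfl
      rw [h1]
      constructor
      · rintro ⟨f, rfl⟩
        exact ⟨Ideal.Quotient.mk _ f, hμ f⟩
      · rintro ⟨y, hy⟩
        obtain ⟨y, rfl⟩ := Ideal.Quotient.mk_surjective y
        rw [hμ, Ideal.Quotient.eq, Ideal.mem_span_singleton] at hy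
        have h2 := (hg ▸ pow_dvd_pow d hjk : d ^ j ∣ g).trans hy
        exact (dvd_sub_right (dvd_mul_right _ _)).1 h2
    have e1 := ψ.finrank_range_add_finrank_ker
    have e2 := μ.finrank_range_add_finrank_ker
    rw [LinearMap.range_eq_top.2 hψ, finrank_top, hker, finrank_quotient_span_eq_natDegree,
      natDegree_pow] at e1
    rw [min_eq_left hjk, mul_comm]
    change Module.finrank F (LinearMap.ker μ) = _
    omega

end QuotientRing

/-! ### Counting invariant factors by kernel dimensions. -/

section InvariantFactors

variable {F V : Type*} [Field F] [AddCommGroup V] [Module F V]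

theorem IsInvariantFactorList.exists_eq_pow {u : Module.End F V} {l : List F[X]}
    (hl : IsInvariantFactorList u l) {d : F[X]} (hd : Irreducible d) (hdm : d.Monic) {n : ℕ}
    (hn : aeval u d ^ n = 0) (i : Fin l.length) : ∃ k, l.get i = d ^ k := by
  obtain ⟨e⟩ := hl.equiv
  have h1 : ∀ x : Module.AEval' u, d ^ n • x = 0 := by
    intro x
    obtain ⟨x, rfl⟩ := (Module.AEval'.of u).surjective x
    have h2 := Module.AEval.of_aeval_smul (a := u) (M := V) (d ^ n) x
    rw [map_pow, hn, zero_smul, map_zero] at h2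
    exact h2.symm
  classical
  have h2 : ∀ y : ((i : Fin l.length) → F[X] ⧸ Ideal.span {l.get i}), d ^ n • y = 0 := by
    intro y
    rw [← e.apply_symm_apply y, ← map_smul, h1, map_zero]
  have h3 := congrFun (h2 1) i
  have h4 : Ideal.Quotient.mk (Ideal.span {l.get i}) (d ^ n * 1) = 0 := h3
  rw [mul_one, Ideal.Quotient.eq_zero_iff_mem, Ideal.mem_span_singleton,
    dvd_prime_pow hd.prime] at h4
  obtain ⟨k, -, hk⟩ := h4
  exact ⟨k, eq_of_monic_of_associated (hl.monic _ (l.get_mem i)) (hdm.pow k) hk⟩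

theorem IsInvariantFactorList.kerPowDim_eq {u : Module.End F V} {l : List F[X]}
    (hl : IsInvariantFactorList u l) {d : F[X]} (hd : d ≠ 0)
    {k : Fin l.length → ℕ} (hk : ∀ i, l.get i = d ^ k i) (j : ℕ) :
    kerPowDim (aeval u d) j = ∑ i, d.natDegree * min j (k i) := by
  obtain ⟨e⟩ := hl.equiv
  have : ∀ i, FiniteDimensional F (F[X] ⧸ Ideal.span {l.get i}) := fun i =>
    finiteDimensional_quotient_span (hk i ▸ pow_ne_zero _ hd)
  rw [kerPowDim_congr ((Module.AEval'.of u).trans (e.restrictScalars F))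
    (g := LinearMap.pi fun i =>
      Algebra.lmul F (F[X] ⧸ Ideal.span {l.get i}) (Ideal.Quotient.mk _ d) ∘ₗ LinearMap.proj i),
    kerPowDim_pi]
  · exact Finset.sum_congr rfl fun i _ => kerPowDim_lmul_quotient hd (hk i) j
  · intro x
    have h2 := Module.AEval.of_aeval_smul (a := u) (M := V) d x
    exact (congrArg e h2).trans (map_smul e d _)

theorem IsInvariantFactorList.blockDim_eq {u : Module.End F V} {l : List F[X]}
    (hl : IsInvariantFactorList u l) {d : F[X]} (hd : Irreducible d) (hdm : d.Monic) {n : ℕ}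
    (hn : aeval u d ^ n = 0) (j : ℕ) :
    blockDim (aeval u d) j = d.natDegree * ({i | l.get i = d ^ (j + 1)}.ncard : ℤ) := by
  choose k hk using hl.exists_eq_pow hd hdm hn
  have hinj : ∀ i, l.get i = d ^ (j + 1) ↔ k i = j + 1 := fun i => by
    rw [hk]
    refine ⟨fun h => ?_, fun h => by rw [h]⟩
    have := congrArg natDegree h
    rw [natDegree_pow, natDegree_pow] at this
    exact Nat.eq_of_mul_eq_mul_right hd.natDegree_pos this
  have hset : {i | l.get i = d ^ (j + 1)} =
      ((Finset.univ.filter fun i => k i = j + 1 : Finset (Fin l.length)) : Set _) := by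
    ext i
    rw [Set.mem_ofPred_eq, hinj]
    simp
  rw [hset, Set.ncard_coe_finset, Finset.card_filter, blockDim, hl.kerPowDim_eq hd.ne_zero hk,
    hl.kerPowDim_eq hd.ne_zero hk, hl.kerPowDim_eq hd.ne_zero hk]
  push_cast
  simp only [Finset.mul_sum, ← Finset.sum_sub_distrib]
  refine Finset.sum_congr rfl fun i _ => ?_
  -- The function j ↦ min(j, k_i) bends only at k_i, so its second difference detects k_i = j + 1.
  have : 2 * min ((j : ℤ) + 1) (k i) - min (j : ℤ) (k i) - min ((j : ℤ) + 2) (k i) =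
      if k i = j + 1 then 1 else 0 := by
    split_ifs with h <;> omega
  rw [← this]
  ring

end InvariantFactors

/-! ### Explicit partners on hyperbolic blocks. -/

section Models

variable {F V W : Type*} [Field F] [AddCommGroup V] [Module F V] [AddCommGroup W] [Module F W]

/-- The orthogonal direct sum of two bilinear forms. -/
noncomputable def orthogonalSum (b : LinearMap.BilinForm F V) (c : LinearMap.BilinForm F W) :
    LinearMap.BilinForm F (V × W) :=
  b.compl₁₂ (LinearMap.fst F V W) (LinearMap.fst F V W) +
    c.compl₁₂ (LinearMap.snd F V W) (LinearMap.snd F V W)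

theorem orthogonalSum_apply (b : LinearMap.BilinForm F V) (c : LinearMap.BilinForm F W)
    (x y : V × W) : orthogonalSum b c x y = b x.1 y.1 + c x.2 y.2 := rfl

theorem HasPartner.congr {τ a e : F} {b : LinearMap.BilinForm F V} {u : Module.End F V}
    {c : LinearMap.BilinForm F W} {w : Module.End F W} (φ : V ≃ₗ[F] W)
    (hb : ∀ x y, c (φ x) (φ y) = b x y) (hu : ∀ x, φ (u x) = w (φ x))
    (h : HasPartner τ a e b u) : HasPartner τ a e c w := by
  obtain ⟨v, h1, h2, h3⟩ := h
  refine ⟨φ.conj v, fun y => ?_, fun y => ?_, fun y => ?_⟩ <;>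
    obtain ⟨x, rfl⟩ := φ.surjective y
  · rw [LinearEquiv.conj_apply_apply, φ.symm_apply_apply, hb, h1]
  · simp only [LinearEquiv.conj_apply_apply, φ.symm_apply_apply, h2, map_add, map_smul]
  · simp only [LinearEquiv.conj_apply_apply, φ.symm_apply_apply, ← hu, ← map_add, ← map_smul, h3]

theorem HasPartner.prodMap {τ a e : F} {b : LinearMap.BilinForm F V} {u : Module.End F V}
    {c : LinearMap.BilinForm F W} {w : Module.End F W} (h : HasPartner τ a e b u)
    (h' : HasPartner τ a e c w) :
    HasPartner τ a e (orthogonalSum b c) (LinearMap.prodMap u w) := by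
  obtain ⟨v, h1, h2, h3⟩ := h
  obtain ⟨v', h1', h2', h3'⟩ := h'
  refine ⟨LinearMap.prodMap v v', fun x => ?_, fun x => ?_, fun x => ?_⟩
  · rw [orthogonalSum_apply]
    change b x.1 (v x.1) + c x.2 (v' x.2) = 0
    rw [h1, h1', add_zero]
  · exact Prod.ext (h2 x.1) (h2' x.2)
  · exact Prod.ext (h3 x.1) (h3' x.2)

variable {R : Type*} [CommRing R] [Algebra F R]

/-- The form `((x, y), (x', y')) ↦ l (x y' + y x')`. -/
noncomputable def hyperbolicForm (l : R →ₗ[F] F) : LinearMap.BilinForm F (R × R) :=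
  LinearMap.mk₂ F (fun z w => l (z.1 * w.2 + z.2 * w.1))
    (fun z z' w => by rw [← map_add]; congr 1; simp; ring)
    (fun r z w => by rw [← map_smul]; congr 1; simp)
    (fun z w w' => by rw [← map_add]; congr 1; simp; ring)
    (fun r z w => by rw [← map_smul]; congr 1; simp)

theorem hyperbolicForm_apply (l : R →ₗ[F] F) (z w : R × R) :
    hyperbolicForm l z w = l (z.1 * w.2 + z.2 * w.1) := rfl

/-- Multiplication by `t` on `R × R`. -/
noncomputable def diagMul (F : Type*) {R : Type*} [Field F] [CommRing R] [Algebra F R] (t : R) :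
    Module.End F (R × R) :=
  LinearMap.prodMap (Algebra.lmul F R t) (Algebra.lmul F R t)

theorem diagMul_apply (t : R) (z : R × R) : diagMul F t z = (t * z.1, t * z.2) := rfl

theorem two_eq_zero_of_algebra [CharP F 2] : (2 : R) = 0 := by
  rw [← map_ofNat (algebraMap F R) 2, CharTwo.two_eq_zero, map_zero]

/-- The partner is v = M + δ with M = (0, a; 1, τ). As M² = τM + a, δ² = τδ and Mδ = δM, one gets v²
= τv + a, while [v, t] = [δ, t] = δ(t). -/
theorem hasPartner_hyperbolicForm [CharP F 2] {τ a e : F} (hτ : τ ≠ 0) {t : R}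
    (δ : Derivation F R R) (hδt : δ t = t * t + τ • t + e • 1)
    (hδδ : ∀ x, δ (δ x) = τ • δ x) {l : R →ₗ[F] F} (hl : ∀ x, l (δ x) = τ * l x) :
    HasPartner τ a e (hyperbolicForm l) (diagMul F t) := by
  have h2 : (2 : R) = 0 := two_eq_zero_of_algebra (F := F)
  -- Squares are killed by δ in characteristic 2, hence by l, because τ l = l∘δ and τ ≠ 0.
  have hsq : ∀ x, l (x * x) = 0 := fun x => by
    have h1 := hl (x * x)
    rw [Derivation.leibniz, smul_eq_mul, ← two_mul, h2, zero_mul, map_zero] at h1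
    exact (mul_eq_zero.1 h1.symm).resolve_left hτ
  let D : R →ₗ[F] R := δ
  let fs := LinearMap.fst F R R
  let sn := LinearMap.snd F R R
  refine ⟨(D ∘ₗ fs + a • sn).prod (fs + τ • sn + D ∘ₗ sn), fun z => ?_, fun z => ?_, fun z => ?_⟩
  · have h3 := hl (z.1 * z.2)
    have h4 := hsq z.1
    have h5 := hsq z.2
    rw [hyperbolicForm_apply]
    change l (z.1 * (z.1 + τ • z.2 + δ z.2) + z.2 * (δ z.1 + a • z.2)) = 0
    have h6 : z.1 * (z.1 + τ • z.2 + δ z.2) + z.2 * (δ z.1 + a • z.2) =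
        z.1 * z.1 + a • (z.2 * z.2) + τ • (z.1 * z.2) + δ (z.1 * z.2) := by
      simp only [Derivation.leibniz, Algebra.smul_def, Algebra.algebraMap_self, RingHom.id_apply]
      ring
    rw [h6]
    simp only [map_add, map_smul, h3, h4, h5, smul_eq_mul, mul_zero, zero_add]
    exact CharTwo.add_self_eq_zero _
  · refine Prod.ext ?_ ?_
    · change δ (δ z.1 + a • z.2) + a • (z.1 + τ • z.2 + δ z.2) =
        τ • (δ z.1 + a • z.2) + a • z.1
      simp only [map_add, Derivation.map_smul, hδδ]
      simp only [Algebra.smul_def]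
      linear_combination algebraMap F R a * δ z.2 * h2
    · change (δ z.1 + a • z.2) + τ • (z.1 + τ • z.2 + δ z.2) + δ (z.1 + τ • z.2 + δ z.2) =
        τ • (z.1 + τ • z.2 + δ z.2) + a • z.2
      simp only [map_add, Derivation.map_smul, hδδ]
      simp only [Algebra.smul_def]
      linear_combination (δ z.1 + algebraMap F R τ * δ z.2) * h2
  · refine Prod.ext ?_ ?_
    · change (δ (t * z.1) + a • (t * z.2)) + t * (δ z.1 + a • z.2) =
        t * (t * z.1) + τ • (t * z.1) + e • z.1
      simp only [Derivation.leibniz, hδt, Algebra.smul_def, Algebra.algebraMap_self,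
        RingHom.id_apply]
      linear_combination (t * δ z.1 + algebraMap F R a * t * z.2) * h2
    · change (t * z.1 + τ • (t * z.2) + δ (t * z.2)) + t * (z.1 + τ • z.2 + δ z.2) =
        t * (t * z.2) + τ • (t * z.2) + e • z.2
      simp only [Derivation.leibniz, hδt, Algebra.smul_def, Algebra.algebraMap_self,
        RingHom.id_apply]
      linear_combination (t * z.1 + algebraMap F R τ * t * z.2 + t * δ z.2) * h2

/-- When l∘δ = 0 the functional need not kill squares, so the companion matrix acts across two
blocks: M + δ on the first coordinates (x, x') and its transpose Mᵀ + δ on the second ones (y, y').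
The matrix terms cancel in pairs, leaving l(δ(xy) + δ(x'y')) = 0. -/
theorem hasPartner_hyperbolicForm_sum [CharP F 2] {τ a e : F} {t : R}
    (δ : Derivation F R R) (hδt : δ t = t * t + τ • t + e • 1)
    (hδδ : ∀ x, δ (δ x) = τ • δ x) {l : R →ₗ[F] F} (hl : ∀ x, l (δ x) = 0) :
    HasPartner τ a e (orthogonalSum (hyperbolicForm l) (hyperbolicForm l))
      (LinearMap.prodMap (diagMul F t) (diagMul F t)) := by
  have h2 : (2 : R) = 0 := two_eq_zero_of_algebra (F := F)
  let D : R →ₗ[F] R := δ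
  let x₁ := LinearMap.fst F R R ∘ₗ LinearMap.fst F (R × R) (R × R)
  let y₁ := LinearMap.snd F R R ∘ₗ LinearMap.fst F (R × R) (R × R)
  let x₂ := LinearMap.fst F R R ∘ₗ LinearMap.snd F (R × R) (R × R)
  let y₂ := LinearMap.snd F R R ∘ₗ LinearMap.snd F (R × R) (R × R)
  refine ⟨((D ∘ₗ x₁ + a • x₂).prod (D ∘ₗ y₁ + y₂)).prod
    ((x₁ + τ • x₂ + D ∘ₗ x₂).prod (a • y₁ + τ • y₂ + D ∘ₗ y₂)), ?_, ?_, ?_⟩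
  · rintro ⟨⟨x, y⟩, x', y'⟩
    rw [orthogonalSum_apply, hyperbolicForm_apply, hyperbolicForm_apply, ← map_add]
    change l (x * (δ y + y') + y * (δ x + a • x') +
      (x' * (a • y + τ • y' + δ y') + y' * (x + τ • x' + δ x'))) = 0
    have h6 : x * (δ y + y') + y * (δ x + a • x') +
        (x' * (a • y + τ • y' + δ y') + y' * (x + τ • x' + δ x')) =
        δ (x * y) + δ (x' * y') := by
      simp only [Derivation.leibniz, Algebra.smul_def, Algebra.algebraMap_self, RingHom.id_apply]
      linear_combination (x * y' + algebraMap F R a * x' * y + algebraMap F R τ * x' * y') * h2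
    rw [h6, map_add, hl, hl, add_zero]
  · rintro ⟨⟨x, y⟩, x', y'⟩
    refine Prod.ext (Prod.ext ?_ ?_) (Prod.ext ?_ ?_)
    · change δ (δ x + a • x') + a • (x + τ • x' + δ x') = τ • (δ x + a • x') + a • x
      simp only [map_add, Derivation.map_smul, hδδ]
      simp only [Algebra.smul_def]
      linear_combination algebraMap F R a * δ x' * h2
    · change δ (δ y + y') + (a • y + τ • y' + δ y') = τ • (δ y + y') + a • y
      simp only [map_add, hδδ, Algebra.smul_def]
      linear_combination δ y' * h2
    · change (δ x + a • x') + τ • (x + τ • x' + δ x') + δ (x + τ • x' + δ x') =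
        τ • (x + τ • x' + δ x') + a • x'
      simp only [map_add, Derivation.map_smul, hδδ]
      simp only [Algebra.smul_def]
      linear_combination (δ x + algebraMap F R τ * δ x') * h2
    · change a • (δ y + y') + τ • (a • y + τ • y' + δ y') + δ (a • y + τ • y' + δ y') =
        τ • (a • y + τ • y' + δ y') + a • y'
      simp only [map_add, Derivation.map_smul, hδδ]
      simp only [Algebra.smul_def]
      linear_combination (algebraMap F R a * δ y + algebraMap F R τ * δ y') * h2
  · rintro ⟨⟨x, y⟩, x', y'⟩
    refine Prod.ext (Prod.ext ?_ ?_) (Prod.ext ?_ ?_)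
    · change (δ (t * x) + a • (t * x')) + t * (δ x + a • x') = t * (t * x) + τ • (t * x) + e • x
      simp only [Derivation.leibniz, hδt, Algebra.smul_def, Algebra.algebraMap_self,
        RingHom.id_apply]
      linear_combination (t * δ x + algebraMap F R a * t * x') * h2
    · change (δ (t * y) + t * y') + t * (δ y + y') = t * (t * y) + τ • (t * y) + e • y
      simp only [Derivation.leibniz, hδt, Algebra.smul_def, Algebra.algebraMap_self,
        RingHom.id_apply]
      linear_combination (t * δ y + t * y') * h2
    · change (t * x + τ • (t * x') + δ (t * x')) + t * (x + τ • x' + δ x') =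
        t * (t * x') + τ • (t * x') + e • x'
      simp only [Derivation.leibniz, hδt, Algebra.smul_def, Algebra.algebraMap_self,
        RingHom.id_apply]
      linear_combination (t * x + algebraMap F R τ * t * x' + t * δ x') * h2
    · change (a • (t * y) + τ • (t * y') + δ (t * y')) + t * (a • y + τ • y' + δ y') =
        t * (t * y') + τ • (t * y') + e • y'
      simp only [Derivation.leibniz, hδt, Algebra.smul_def, Algebra.algebraMap_self,
        RingHom.id_apply]
      linear_combination (algebraMap F R a * t * y + algebraMap F R τ * t * y' + t * δ y') * h2

end Models

/-! ### The derivation d·d/dt on F[t]/(d^k) and functionals adapted to it. -/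

section QuotientDerivation

variable {F : Type*} [Field F]

theorem derivative_derivative_of_charTwo [CharP F 2] (f : F[X]) : derivative (derivative f) = 0 := by
  have h := factorial_smul_hasseDeriv (R := F) 2
  have h1 := congrFun h f
  change derivative (derivative f) = 0
  have h2 : derivative^[2] f = derivative (derivative f) := rfl
  rw [← h2, ← h1, LinearMap.smul_apply, Nat.factorial_two, ← Nat.cast_smul_eq_nsmul F]
  simp [CharTwo.two_eq_zero]

theorem derivative_quadPoly [CharP F 2] (τ e : F) : derivative (quadPoly τ e) = C τ := by
  simp [quadPoly, one_add_one_eq_two, CharTwo.two_eq_zero]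

/-- On `F[t] / (d ^ k)` with `d = t² + τ t + e`, the derivation `d · (d/dt)`. -/
theorem exists_quotient_derivation (τ e : F) (k : ℕ) :
    ∃ δ : Derivation F (F[X] ⧸ Ideal.span {quadPoly τ e ^ k})
        (F[X] ⧸ Ideal.span {quadPoly τ e ^ k}),
      ∀ f, δ (Ideal.Quotient.mk _ f) = Ideal.Quotient.mk _ (quadPoly τ e * derivative f) := by
  let P : Derivation F F[X] F[X] := quadPoly τ e • derivative'
  have hP : ∀ f, P f = quadPoly τ e * derivative f := fun f => rfl
  let π := Ideal.Quotient.mkₐ F (Ideal.span {quadPoly τ e ^ k})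
  have hπ : ∀ f, π f = 0 ↔ quadPoly τ e ^ k ∣ f := fun f => by
    rw [← Ideal.mem_span_singleton, ← Ideal.Quotient.eq_zero_iff_mem]; rfl
  have hd : ∀ f, π f = 0 → π (P f) = 0 := by
    intro f
    rw [hπ, hπ, hP]
    rintro ⟨g, rfl⟩
    rw [derivative_mul, derivative_pow]
    -- The factor d compensates the power lost by differentiating d^k, so the ideal (d^k) is stable.
    -- The case k = 0 is apart because `derivative_pow` involves k - 1.
    rcases k with _ | k
    · simp
    · refine ⟨C ((k + 1 : ℕ) : F) * derivative (quadPoly τ e) * g + quadPoly τ e * derivative g, ?_⟩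
      simp only [Nat.add_sub_cancel]
      ring
  exact ⟨Derivation.liftOfSurjective (f := π) Ideal.Quotient.mk_surjective hd, fun f =>
    Derivation.liftOfSurjective_apply (f := π) Ideal.Quotient.mk_surjective hd f⟩

theorem quotient_derivation_properties [CharP F 2] {τ e : F} {k : ℕ}
    {δ : Derivation F (F[X] ⧸ Ideal.span {quadPoly τ e ^ k})
        (F[X] ⧸ Ideal.span {quadPoly τ e ^ k})}
    (hδ : ∀ f, δ (Ideal.Quotient.mk _ f) = Ideal.Quotient.mk _ (quadPoly τ e * derivative f)) :
    (δ (Ideal.Quotient.mk _ X) = Ideal.Quotient.mk _ X * Ideal.Quotient.mk _ X +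
      τ • Ideal.Quotient.mk _ X + e • 1) ∧ (∀ x, δ (δ x) = τ • δ x) ∧
    ∀ n : ℕ, δ (Ideal.Quotient.mk _ (quadPoly τ e ^ n)) =
      (n * τ : F) • Ideal.Quotient.mk _ (quadPoly τ e ^ n) := by
  have hC : ∀ (r : F) (f : F[X]), r • (Ideal.Quotient.mk (Ideal.span {quadPoly τ e ^ k}) f) =
      Ideal.Quotient.mk _ (C r * f) := fun r f => by rw [← smul_eq_C_mul]; rfl
  refine ⟨?_, fun x => ?_, fun n => ?_⟩
  · rw [hδ, hC, ← map_one (Ideal.Quotient.mk _), hC, ← map_mul, ← map_add, ← map_add, quadPoly,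
      derivative_X]
    congr 1
    ring
  · obtain ⟨f, rfl⟩ := Ideal.Quotient.mk_surjective x
    rw [hδ, hδ, hC, derivative_mul, derivative_quadPoly, derivative_derivative_of_charTwo]
    congr 1
    ring
  · rw [hδ, hC, derivative_pow, derivative_quadPoly]
    congr 1
    rcases n with _ | n
    · simp
    · simp only [Nat.add_sub_cancel, map_mul, map_natCast]
      ring

/-- Since δ² = τδ with τ ≠ 0, δ is diagonalisable with eigenvalues among 0 and τ, and kτ is one of
these. As d^k is an eigenvector for kτ, it lies outside the range of δ - kτ. A functional vanishing
on that range but not at d^k is what is needed. -/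
theorem exists_functional [CharP F 2] {τ e : F} (hτ : τ ≠ 0) {k : ℕ}
    {δ : Derivation F (F[X] ⧸ Ideal.span {quadPoly τ e ^ (k + 1)})
        (F[X] ⧸ Ideal.span {quadPoly τ e ^ (k + 1)})}
    (hδ : ∀ f, δ (Ideal.Quotient.mk _ f) = Ideal.Quotient.mk _ (quadPoly τ e * derivative f)) :
    ∃ l : (F[X] ⧸ Ideal.span {quadPoly τ e ^ (k + 1)}) →ₗ[F] F,
      l (Ideal.Quotient.mk _ (quadPoly τ e ^ k)) ≠ 0 ∧ ∀ x, l (δ x) = k * τ * l x := by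
  obtain ⟨-, hδδ, hpow⟩ := quotient_derivation_properties hδ
  have hne : Ideal.Quotient.mk (Ideal.span {quadPoly τ e ^ (k + 1)}) (quadPoly τ e ^ k) ≠ 0 := by
    rw [Ne, Ideal.Quotient.eq_zero_iff_mem, Ideal.mem_span_singleton]
    intro h
    have h1 := natDegree_le_of_dvd h ((quadPoly_monic τ e).pow k).ne_zero
    rw [natDegree_pow, natDegree_pow, quadPoly_natDegree] at h1
    omega
  have hk : (k : F) * k = k := by
    rcases Nat.even_or_odd k with h | h
    · rw [(CharP.cast_eq_zero_iff F 2 k).2 h.two_dvd, zero_mul]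
    · obtain ⟨m, rfl⟩ := h
      push_cast
      linear_combination (2 * m ^ 2 + m : F) * (CharTwo.two_eq_zero (R := F))
  have h2 : (2 : F) = 0 := CharTwo.two_eq_zero
  let D := δ.toLinearMap
  let G := D - (k * τ : F) • LinearMap.id
  have hG : ∀ x, G x = δ x - (k * τ : F) • x := fun x => rfl
  have hnotMem : Ideal.Quotient.mk (Ideal.span {quadPoly τ e ^ (k + 1)}) (quadPoly τ e ^ k) ∉
      LinearMap.range G := by
    rintro ⟨x, hx⟩
    rw [hG] at hx
    have h3 := hpow k
    rw [← hx, map_sub, Derivation.map_smul, hδδ] at h3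
    have h4 : τ • (δ x - (k * τ : F) • x) = 0 := by
      have hkx : ∀ y : F[X] ⧸ Ideal.span {quadPoly τ e ^ (k + 1)},
        (k * k : F) • y = (k : F) • y := fun y => by rw [hk]
      have htwo : ∀ y : F[X] ⧸ Ideal.span {quadPoly τ e ^ (k + 1)}, (2 : F) • y = 0 :=
        fun y => by rw [h2, zero_smul]
      linear_combination (norm := module) h3 - τ ^ 2 • hkx x + htwo ((k * τ : F) • δ x) -
        htwo ((k * τ ^ 2 : F) • x)
    rw [hx] at h4
    exact hne ((smul_eq_zero.1 h4).resolve_left hτ)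
  obtain ⟨l, hl, hle⟩ := Submodule.exists_le_ker_of_notMem hnotMem
  refine ⟨l, hl, fun x => ?_⟩
  have h3 : l (G x) = 0 := hle ⟨x, rfl⟩
  rw [hG, map_sub, map_smul, smul_eq_mul] at h3
  exact sub_eq_zero.1 h3

end QuotientDerivation

/-! ### Splitting off a hyperbolic block. -/

section Splitting

variable {F V : Type*} [Field F] [AddCommGroup V] [Module F V]

theorem apply_aeval_comm {b : LinearMap.BilinForm F V} {u : Module.End F V}
    (hu : ∀ x y, b (u x) y = b x (u y)) (f : F[X]) (x y : V) :
    b (aeval u f x) y = b x (aeval u f y) := by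
  induction f using Polynomial.induction_on' with
  | add f g hf hg => simp [hf, hg]
  | monomial n r => simp [aeval_monomial, Module.algebraMap_end_apply, apply_pow_comm hu]

/-- For an even power, b(x, u^(2i) x) = b(u^i x, u^i x); for an odd one, b(x, u^(2i+1) x) = b(u^i x,
u u^i x). Both vanish. -/
theorem IsSymplecticPair.apply_aeval_eq_zero {b : LinearMap.BilinForm F V} {u : Module.End F V}
    (hbu : IsSymplecticPair b u) (f : F[X]) (x : V) : b x (aeval u f x) = 0 := by
  have hu := hbu.alternating.apply_comm hbu.isAlt
  induction f using Polynomial.induction_on' with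
  | add f g hf hg => simp [hf, hg]
  | monomial n r =>
    have h : b x ((u ^ n) x) = 0 := by
      obtain ⟨i, rfl | rfl⟩ := Nat.even_or_odd' n
      · rw [two_mul, pow_add, Module.End.mul_apply, ← apply_pow_comm hu]
        exact hbu.isAlt _
      · rw [two_mul, add_assoc, pow_add, pow_succ', Module.End.mul_apply, ← apply_pow_comm hu]
        exact hbu.alternating _
    simp [aeval_monomial, Module.algebraMap_end_apply, h]

/-- Every nonzero ideal of F[t]/(d^(k+1)) contains d^k. Therefore nonvanishing at d^k is enough for
injectivity and nondegeneracy below. -/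
theorem exists_mul_eq_mod_of_not_dvd {d f : F[X]} (hd : Irreducible d) {k : ℕ}
    (hf : ¬ d ^ (k + 1) ∣ f) : ∃ h s, d ^ k = f * h + d ^ (k + 1) * s := by
  classical
  obtain ⟨i, hi, h1⟩ := (dvd_prime_pow hd.prime _).1
    (EuclideanDomain.gcd_dvd_right f (d ^ (k + 1)))
  have hik : i ≤ k := by
    rcases Nat.lt_or_ge k i with h | h
    · obtain rfl : i = k + 1 := by omega
      exact absurd (h1.symm.dvd.trans (EuclideanDomain.gcd_dvd_left f (d ^ (k + 1)))) hf
    · exact h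
  obtain ⟨c, hc⟩ := h1.dvd.trans (pow_dvd_pow d hik)
  refine ⟨EuclideanDomain.gcdA f (d ^ (k + 1)) * c, EuclideanDomain.gcdB f (d ^ (k + 1)) * c, ?_⟩
  rw [hc, EuclideanDomain.gcd_eq_gcd_ab f (d ^ (k + 1))]
  ring

theorem hyperbolicForm_eq_zero {d : F[X]} (hd : Irreducible d) {k : ℕ}
    {l : (F[X] ⧸ Ideal.span {d ^ (k + 1)}) →ₗ[F] F} (hl : l (Ideal.Quotient.mk _ (d ^ k)) ≠ 0)
    {z : (F[X] ⧸ Ideal.span {d ^ (k + 1)}) × (F[X] ⧸ Ideal.span {d ^ (k + 1)})}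
    (hz : ∀ w, hyperbolicForm l z w = 0) : z = 0 := by
  have key : ∀ x, (∀ y, l (x * y) = 0) → x = 0 := by
    intro x hx
    obtain ⟨f, rfl⟩ := Ideal.Quotient.mk_surjective x
    rw [Ideal.Quotient.eq_zero_iff_mem, Ideal.mem_span_singleton]
    by_contra hf
    obtain ⟨h, s, hs⟩ := exists_mul_eq_mod_of_not_dvd hd hf
    refine hl ?_
    rw [← hx (Ideal.Quotient.mk _ h), ← map_mul]
    congr 1
    rw [Ideal.Quotient.eq, Ideal.mem_span_singleton]
    exact ⟨s, by rw [hs]; ring⟩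
  refine Prod.ext (key _ fun y => ?_) (key _ fun y => ?_)
  · simpa [hyperbolicForm_apply] using hz (0, y)
  · simpa [hyperbolicForm_apply] using hz (y, 0)

/-- A vector x with d(u)^k x ≠ 0 generates a free module Rx over R = F[t]/(d^(k+1)). Nondegeneracy
of b provides y with b(rx, y) = l(r). As Rx and Ry are totally isotropic, b is the hyperbolic form
of l on Rx + Ry, and the orthogonal complement is stable under u. The freedom in l is what later
allows a choice adapted to δ. -/
theorem exists_orthogonal_splitting [CharP F 2] [FiniteDimensional F V]
    {b : LinearMap.BilinForm F V} {u : Module.End F V} (hbu : IsSymplecticPair b u)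
    {d : F[X]} (hd : Irreducible d) {k : ℕ} (hk : aeval u d ^ (k + 1) = 0)
    (hk' : aeval u d ^ k ≠ 0) {l : (F[X] ⧸ Ideal.span {d ^ (k + 1)}) →ₗ[F] F}
    (hl : l (Ideal.Quotient.mk _ (d ^ k)) ≠ 0) :
    ∃ (W : Submodule F V) (b' : LinearMap.BilinForm F W) (u' : Module.End F W)
      (φ : (((F[X] ⧸ Ideal.span {d ^ (k + 1)}) × (F[X] ⧸ Ideal.span {d ^ (k + 1)})) × W) ≃ₗ[F] V),
      IsSymplecticPair b' u' ∧
      (∀ z, φ (LinearMap.prodMap (diagMul F (Ideal.Quotient.mk _ X)) u' z) = u (φ z)) ∧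
      ∀ z w, b (φ z) (φ w) = orthogonalSum (hyperbolicForm l) b' z w := by
  have hsymm : ∀ x y, b x y = b y x := fun x y => by
    rw [← hbu.isAlt.neg_eq, CharTwo.neg_eq]
  have hsu := hbu.alternating.apply_comm hbu.isAlt
  obtain ⟨x, hx⟩ : ∃ x, (aeval u d ^ k) x ≠ 0 := by
    by_contra! h
    exact hk' (LinearMap.ext h)
  let Φ : (F[X] ⧸ Ideal.span {d ^ (k + 1)}) →ₐ[F] Module.End F V :=
    Ideal.Quotient.liftₐ _ (aeval u) (by
      intro f hf
      obtain ⟨f, rfl⟩ := Ideal.mem_span_singleton.1 hf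
      rw [map_mul, map_pow, hk, zero_mul])
  have hΦ : ∀ f, Φ (Ideal.Quotient.mk _ f) = aeval u f := fun f => rfl
  have hΦs : ∀ r x y, b (Φ r x) y = b x (Φ r y) := fun r x y => by
    obtain ⟨f, rfl⟩ := Ideal.Quotient.mk_surjective r
    exact apply_aeval_comm hsu f x y
  have hΦ0 : ∀ r x, b x (Φ r x) = 0 := fun r x => by
    obtain ⟨f, rfl⟩ := Ideal.Quotient.mk_surjective r
    exact hbu.apply_aeval_eq_zero f x
  let ι := LinearMap.applyₗ x ∘ₗ Φ.toLinearMap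
  have hι : ∀ r, ι r = Φ r x := fun r => rfl
  have hinj : LinearMap.ker ι = ⊥ := by
    rw [LinearMap.ker_eq_bot']
    intro r hr
    obtain ⟨f, rfl⟩ := Ideal.Quotient.mk_surjective r
    rw [Ideal.Quotient.eq_zero_iff_mem, Ideal.mem_span_singleton]
    by_contra hf
    obtain ⟨h, s, hs⟩ := exists_mul_eq_mod_of_not_dvd hd hf
    refine hx ?_
    rw [hι, hΦ] at hr
    rw [← map_pow, hs, map_add, map_mul, map_mul, map_pow, hk, zero_mul, add_zero, ← map_mul,
      mul_comm, map_mul, Module.End.mul_apply, hr, map_zero]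
  -- A left inverse g of r ↦ rx extends l to the functional l∘g on V, which b then represents by y.
  obtain ⟨g, hg⟩ := LinearMap.exists_leftInverse_of_injective ι hinj
  obtain ⟨y, hy⟩ : ∃ y, ∀ r, b (Φ r x) y = l r := by
    refine ⟨(b.toDual hbu.nondegenerate).symm (l ∘ₗ g), fun r => ?_⟩
    rw [hsymm, LinearMap.BilinForm.apply_toDual_symm_apply]
    exact congrArg l (LinearMap.congr_fun hg r)
  let θ : ((F[X] ⧸ Ideal.span {d ^ (k + 1)}) × (F[X] ⧸ Ideal.span {d ^ (k + 1)})) →ₗ[F] V :=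
    ι.coprod (LinearMap.applyₗ y ∘ₗ Φ.toLinearMap)
  have hθ : ∀ z, θ z = Φ z.1 x + Φ z.2 y := fun z => rfl
  have hθu : ∀ z, θ (diagMul F (Ideal.Quotient.mk _ X) z) = u (θ z) := by
    intro z
    simp only [hθ, diagMul_apply, map_mul, hΦ, aeval_X, map_add, Module.End.mul_apply]
  have hθb : ∀ z w, b (θ z) (θ w) = hyperbolicForm l z w := by
    intro z w
    have e1 : ∀ r s, b (Φ r x) (Φ s y) = l (r * s) := fun r s => by
      rw [← hΦs, ← hy, mul_comm, map_mul, Module.End.mul_apply]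
    have e2 : ∀ r s v, b (Φ r v) (Φ s v) = 0 := fun r s v => by
      rw [hΦs, ← Module.End.mul_apply, ← map_mul, hΦ0]
    rw [hθ, hθ, hyperbolicForm_apply]
    simp only [map_add, LinearMap.add_apply, e1, e2]
    rw [hsymm, e1, mul_comm w.1]
    ring
  have hθinj : Function.Injective θ := by
    rw [injective_iff_map_eq_zero]
    intro z hz
    refine hyperbolicForm_eq_zero hd hl fun w => ?_
    rw [← hθb, hz, map_zero, LinearMap.zero_apply]
  have hnd : (b.restrict (LinearMap.range θ)).Nondegenerate := by
    have h : ∀ z : LinearMap.range θ, (∀ w : LinearMap.range θ, b z w = 0) → z = 0 := by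
      rintro ⟨_, z, rfl⟩ hz
      obtain rfl : z = 0 := hyperbolicForm_eq_zero hd hl fun w => by
        rw [← hθb]; exact hz ⟨_, w, rfl⟩
      exact Subtype.ext (map_zero θ)
    exact ⟨h, fun z hz => h z fun w => (hsymm _ _).trans (hz w)⟩
  have hcompl := LinearMap.BilinForm.isCompl_orthogonal_of_restrict_nondegenerate
    hbu.isAlt.isRefl hnd
  have horth : ∀ z, ∀ w ∈ b.orthogonal (LinearMap.range θ), b (θ z) w = 0 :=
    fun z w hw => hw _ ⟨z, rfl⟩
  have huW : ∀ w ∈ b.orthogonal (LinearMap.range θ), u w ∈ b.orthogonal (LinearMap.range θ) := by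
    rintro w hw _ ⟨z, rfl⟩
    change b (θ z) (u w) = 0
    rw [← hsu, ← hθu, horth _ _ hw]
  let φ := ((LinearEquiv.ofInjective θ hθinj).prodCongr
    (LinearEquiv.refl F (b.orthogonal (LinearMap.range θ)))).trans
      (Submodule.prodEquivOfIsCompl _ _ hcompl)
  have hφ : ∀ z, φ z = θ z.1 + z.2 := fun z => rfl
  refine ⟨b.orthogonal (LinearMap.range θ), b.restrict _, u.restrict huW, φ, ⟨?_, ?_, ?_⟩, ?_, ?_⟩
  · exact fun w => hbu.isAlt w
  · have h : ∀ w : b.orthogonal (LinearMap.range θ),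
        (∀ w' : b.orthogonal (LinearMap.range θ), b w w' = 0) → w = 0 := by
      intro w hw
      refine Subtype.ext (hbu.nondegenerate.1 _ fun v => ?_)
      obtain ⟨z, rfl⟩ := φ.surjective v
      rw [hφ, map_add, hw, hsymm, horth _ _ w.2, add_zero]
    exact ⟨h, fun z hz => h z fun w => (hsymm _ _).trans (hz w)⟩
  · exact fun w => hbu.alternating w
  · intro z
    rw [hφ, hφ, map_add, ← hθu]
    rfl
  · intro z w
    rw [hφ, hφ, orthogonalSum_apply]
    simp only [map_add, LinearMap.add_apply, hθb, horth _ _ w.2.2]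
    rw [hsymm z.2, horth _ _ z.2.2, zero_add, add_zero]
    rfl

end Splitting

/-! ### Sufficiency by induction on the dimension. -/

section Existence

variable {F : Type*} [Field F]

theorem blockDim_congr {V W : Type*} [AddCommGroup V] [Module F V] [AddCommGroup W] [Module F W]
    (e : V ≃ₗ[F] W) {f : Module.End F V} {g : Module.End F W}
    (h : ∀ x, e (f x) = g (e x)) (j : ℕ) : blockDim f j = blockDim g j := by
  simp only [blockDim, kerPowDim_congr e h]

theorem blockDim_prodMap {V W : Type*} [AddCommGroup V] [Module F V] [AddCommGroup W] [Module F W]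
    [FiniteDimensional F V] [FiniteDimensional F W] (f : Module.End F V) (g : Module.End F W)
    (j : ℕ) : blockDim (LinearMap.prodMap f g) j = blockDim f j + blockDim g j := by
  simp only [blockDim, kerPowDim_prodMap]
  push_cast
  ring

theorem blockDim_of_pow_eq_zero {V : Type*} [AddCommGroup V] [Module F V]
    {f : Module.End F V} {j : ℕ} (h : f ^ j = 0) : blockDim f j = 0 := by
  rw [blockDim, kerPowDim_of_pow_eq_zero h, kerPowDim_of_pow_eq_zero (pow_eq_zero_of_le (by omega) h),
    kerPowDim_of_pow_eq_zero (pow_eq_zero_of_le (Nat.le_add_right _ 2) h)]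
  ring

theorem blockDim_diagMul {d : F[X]} (hd : d ≠ 0) (k j : ℕ) :
    blockDim (diagMul F (Ideal.Quotient.mk (Ideal.span {d ^ (k + 1)}) d)) j =
      if j = k then 2 * (d.natDegree : ℤ) else 0 := by
  have := finiteDimensional_quotient_span (pow_ne_zero (k + 1) hd)
  rw [diagMul, blockDim_prodMap, blockDim, kerPowDim_lmul_quotient hd rfl,
    kerPowDim_lmul_quotient hd rfl, kerPowDim_lmul_quotient hd rfl]
  have h : 2 * min ((j : ℤ) + 1) (k + 1) - min (j : ℤ) (k + 1) - min ((j : ℤ) + 2) (k + 1) =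
      if j = k then 1 else 0 := by
    split_ifs with h <;> omega
  push_cast
  split_ifs at h ⊢ <;> linear_combination 2 * (d.natDegree : ℤ) * h

theorem aeval_diagMul (f : F[X]) {R : Type*} [CommRing R] [Algebra F R] (t : R) (z : R × R) :
    aeval (diagMul F t) f z = diagMul F (aeval t f) z := by
  induction f using Polynomial.induction_on' with
  | add f g hf hg =>
    rw [map_add, LinearMap.add_apply, hf, hg, map_add]
    simp [diagMul_apply, add_mul]
  | monomial n r =>
    have h : ∀ z, (diagMul F t ^ n) z = diagMul F (t ^ n) z := by
      induction n with
      | zero => intro z; simp [diagMul_apply]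
      | succ n ih =>
        intro z
        rw [pow_succ', Module.End.mul_apply, ih, pow_succ']
        simp [diagMul_apply, mul_assoc]
    rw [aeval_monomial, Module.End.mul_apply, h, aeval_monomial, Module.algebraMap_end_apply]
    simp [diagMul_apply, Algebra.smul_def, mul_assoc]

theorem map_aeval_of_intertwining {V W : Type*} [AddCommGroup V] [Module F V] [AddCommGroup W]
    [Module F W] {φ : V →ₗ[F] W} {f : Module.End F V} {g : Module.End F W}
    (h : ∀ x, φ (f x) = g (φ x)) (p : F[X]) (x : V) :
    φ (aeval f p x) = aeval g p (φ x) := by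
  induction p using Polynomial.induction_on' with
  | add p q hp hq => simp [hp, hq]
  | monomial n r =>
    have hpow : ∀ x, φ ((f ^ n) x) = (g ^ n) (φ x) := by
      induction n with
      | zero => exact fun x => rfl
      | succ n ih => intro x; rw [pow_succ, pow_succ, Module.End.mul_apply, ih, h]; rfl
    simp [aeval_monomial, Module.algebraMap_end_apply, hpow]

theorem exists_orthogonal_splitting_blockDim [CharP F 2] {V : Type*} [AddCommGroup V] [Module F V]
    [FiniteDimensional F V] {d : F[X]} (hd : Irreducible d)
    {b : LinearMap.BilinForm F V} {u : Module.End F V} (hbu : IsSymplecticPair b u)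
    {k : ℕ} (hk : aeval u d ^ (k + 1) = 0) (hk' : aeval u d ^ k ≠ 0)
    {l : (F[X] ⧸ Ideal.span {d ^ (k + 1)}) →ₗ[F] F}
    (hl : l (Ideal.Quotient.mk _ (d ^ k)) ≠ 0) :
    ∃ (W : Submodule F V) (b' : LinearMap.BilinForm F W) (u' : Module.End F W),
      IsSymplecticPair b' u' ∧ Module.finrank F W < Module.finrank F V ∧
      aeval u' d ^ (k + 1) = 0 ∧
      (∀ j, blockDim (aeval u d) j =
        (if j = k then 2 * (d.natDegree : ℤ) else 0) + blockDim (aeval u' d) j) ∧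
      ∃ φ : (((F[X] ⧸ Ideal.span {d ^ (k + 1)}) ×
          (F[X] ⧸ Ideal.span {d ^ (k + 1)})) × W) ≃ₗ[F] V,
        (∀ z, φ (LinearMap.prodMap (diagMul F (Ideal.Quotient.mk _ X)) u' z) = u (φ z)) ∧
        ∀ z w, b (φ z) (φ w) = orthogonalSum (hyperbolicForm l) b' z w := by
  obtain ⟨W, b', u', φ, hbu', hφu, hφb⟩ := exists_orthogonal_splitting hbu hd hk hk' hl
  have := finiteDimensional_quotient_span (pow_ne_zero (k + 1) hd.ne_zero)
  have hW : ∀ f w, φ (0, aeval u' f w) = aeval u f (φ (0, w)) :=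
    map_aeval_of_intertwining (φ := φ.toLinearMap ∘ₗ LinearMap.inr F _ W) fun w => by
      rw [LinearMap.comp_apply, LinearMap.comp_apply, LinearEquiv.coe_coe, ← hφu]
      congr 1
      exact Prod.ext (map_zero (diagMul F (Ideal.Quotient.mk _ X))).symm rfl
  have hR : ∀ z, φ (diagMul F (Ideal.Quotient.mk _ d) z, 0) = aeval u d (φ (z, 0)) := by
    intro z
    have h2 : Ideal.Quotient.mk (Ideal.span {d ^ (k + 1)}) d =
        aeval (Ideal.Quotient.mk (Ideal.span {d ^ (k + 1)}) X) d := by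
      have := aeval_algHom_apply (Ideal.Quotient.mkₐ F (Ideal.span {d ^ (k + 1)})) X d
      rw [aeval_X_left_apply] at this
      exact this.symm
    rw [h2, ← aeval_diagMul]
    refine map_aeval_of_intertwining (φ := φ.toLinearMap ∘ₗ LinearMap.inl F _ W) (fun w => ?_) d z
    rw [LinearMap.comp_apply, LinearMap.comp_apply, LinearEquiv.coe_coe, ← hφu]
    congr 1
    exact Prod.ext rfl (map_zero u').symm
  have hφd : ∀ z, φ (LinearMap.prodMap (diagMul F (Ideal.Quotient.mk _ d)) (aeval u' d) z) =
      aeval u d (φ z) := by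
    rintro ⟨z, w⟩
    have h3 := congrArg₂ (· + ·) (hR z) (hW d w)
    simp only [← map_add, Prod.mk_add_mk, add_zero, zero_add] at h3
    exact h3
  refine ⟨W, b', u', hbu', ?_, ?_, fun j => ?_, φ, hφu, hφb⟩
  · rw [← φ.finrank_eq, Module.finrank_prod, Module.finrank_prod,
      finrank_quotient_span_eq_natDegree, natDegree_pow]
    have := Nat.mul_pos k.succ_pos hd.natDegree_pos
    simp only [Nat.succ_eq_add_one] at this
    omega
  · refine LinearMap.ext fun w => ?_
    have h := hW (d ^ (k + 1)) w
    rw [map_pow, map_pow, hk, LinearMap.zero_apply, map_eq_zero_iff _ φ.injective] at h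
    exact congrArg Prod.snd h
  · rw [← blockDim_congr φ hφd, blockDim_prodMap, blockDim_diagMul hd.ne_zero]

/-- With k + 1 the nilpotency index of d(u), one block is removed if k is odd and two if k is even.
In either case the divisibility by 8 at even indices passes to the remainder. -/
theorem hasPartner_of_eight_dvd_blockDim [CharP F 2] {τ a e : F} (hτ : τ ≠ 0)
    (hd : Irreducible (quadPoly τ e)) {V : Type*} [AddCommGroup V] [Module F V]
    [FiniteDimensional F V] {b : LinearMap.BilinForm F V} {u : Module.End F V}
    (hbu : IsSymplecticPair b u) {n : ℕ} (hn : aeval u (quadPoly τ e) ^ n = 0)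
    (h8 : ∀ m, 8 ∣ blockDim (aeval u (quadPoly τ e)) (2 * m)) : HasPartner τ a e b u := by
  induction hr : Module.finrank F V using Nat.strong_induction_on generalizing V n with
  | _ r ih =>
  subst hr
  rcases subsingleton_or_nontrivial V with hV | hV
  · exact ⟨0, fun x => by simp, fun x => Subsingleton.elim _ _, fun x => Subsingleton.elim _ _⟩
  classical
  have hex : ∃ n, aeval u (quadPoly τ e) ^ n = 0 := ⟨n, hn⟩
  obtain ⟨k, hk⟩ : ∃ k, Nat.find hex = k + 1 := by
    refine Nat.exists_eq_succ_of_ne_zero fun h0 => ?_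
    have h1 := Nat.find_spec hex
    rw [h0, pow_zero] at h1
    exact one_ne_zero h1
  have hk1 : aeval u (quadPoly τ e) ^ (k + 1) = 0 := hk ▸ Nat.find_spec hex
  have hk2 : aeval u (quadPoly τ e) ^ k ≠ 0 := Nat.find_min hex (by omega)
  obtain ⟨δ, hδ⟩ := exists_quotient_derivation τ e (k + 1)
  obtain ⟨hδX, hδδ, -⟩ := quotient_derivation_properties hδ
  obtain ⟨l, hl, hlδ⟩ := exists_functional hτ hδ
  obtain ⟨W, b', u', hbu', hlt, hnW, hblock, φ, hφu, hφb⟩ :=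
    exists_orthogonal_splitting_blockDim hd hbu hk1 hk2 hl
  rcases Nat.even_or_odd k with hkp | hkp
  · have hl0 : ∀ x, l (δ x) = 0 := fun x => by
      rw [hlδ, (CharP.cast_eq_zero_iff F 2 k).2 hkp.two_dvd, zero_mul, zero_mul]
    -- One block contributes 2 deg d = 4 to `blockDim` at k. By divisibility by 8 it cannot be the
    -- only one, so a second block of the same size splits off.
    have hk3 : aeval u' (quadPoly τ e) ^ k ≠ 0 := by
      intro h
      obtain ⟨m, rfl⟩ := hkp.two_dvd
      have h1 := h8 m
      rw [hblock, if_pos rfl, blockDim_of_pow_eq_zero h, quadPoly_natDegree] at h1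
      omega
    obtain ⟨W₂, b₂, u₂, hbu₂, hlt₂, hnW₂, hblock₂, φ₂, hφu₂, hφb₂⟩ :=
      exists_orthogonal_splitting_blockDim hd hbu' hnW hk3 hl
    have h1 : HasPartner τ a e b₂ u₂ := by
      refine ih _ (hlt₂.trans hlt) hbu₂ hnW₂ (fun m => ?_) rfl
      have h2 := h8 m
      rw [hblock, hblock₂, quadPoly_natDegree] at h2
      split_ifs at h2 <;> omega
    refine ((hasPartner_hyperbolicForm_sum δ hδX hδδ hl0).prodMap h1).congr
      ((LinearEquiv.prodAssoc F _ _ W₂).trans (((LinearEquiv.refl F _).prodCongr φ₂).trans φ))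
      ?_ ?_
    · rintro ⟨⟨z, z'⟩, w⟩ ⟨⟨y, y'⟩, v⟩
      change b (φ (z, φ₂ (z', w))) (φ (y, φ₂ (y', v))) = _
      simp only [hφb, orthogonalSum_apply, hφb₂, add_assoc]
    · rintro ⟨⟨z, z'⟩, w⟩
      change φ (diagMul F _ z, φ₂ (LinearMap.prodMap (diagMul F _) u₂ (z', w))) =
        u (φ (z, φ₂ (z', w)))
      rw [hφu₂, ← hφu]
      rfl
  · have hl1 : ∀ x, l (δ x) = τ * l x := fun x => by
      obtain ⟨m, rfl⟩ := hkp
      rw [hlδ]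
      push_cast
      linear_combination (m * τ * l x) * (CharTwo.two_eq_zero (R := F))
    have h1 : HasPartner τ a e b' u' := by
      refine ih _ hlt hbu' hnW (fun m => ?_) rfl
      have h2 := h8 m
      have h3 : 2 * m ≠ k := by
        rintro rfl
        exact (Nat.not_odd_iff_even.2 (even_two_mul m)) hkp
      rwa [hblock, if_neg h3, zero_add] at h2
    exact ((hasPartner_hyperbolicForm hτ δ hδX hδδ hl1).prodMap h1).congr φ hφb hφu

end Existence

/-! ### The equivalence. -/

section Main

theorem IsExceptional.exists_pow_eq_zero {F V : Type*} [Field F] [AddCommGroup V] [Module F V]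
    [FiniteDimensional F V] {p q : F[X]} {u : Module.End F V} (hu : IsExceptional p q u) :
    ∃ n, aeval u (fundamentalPolynomial p q) ^ n = 0 := by
  refine ⟨Module.finrank F V, LinearMap.ext fun x => ?_⟩
  have hx : x ∈ ⋃ n : ℕ,
      (LinearMap.ker (aeval u (fundamentalPolynomial p q) ^ n) : Set V) := by
    rw [hu]; trivial
  obtain ⟨n, hn⟩ := Set.mem_iUnion.1 hx
  exact Module.End.ker_pow_le_ker_pow_finrank _ n hn

theorem mainTheorem4 {F V : Type*} [Field F] [CharP F 2] [AddCommGroup V] [Module F V]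
    [FiniteDimensional F V] (p q : F[X])
    (hp : p.Monic) (hp2 : p.natDegree = 2) (hpi : Irreducible p)
    (hq : q.Monic) (hq2 : q.natDegree = 2) (hqi : Irreducible q)
    (hsplit : splittingFieldInClosure p ≠ splittingFieldInClosure q)
    (htr : polyTrace p = polyTrace q) (htr0 : polyTrace p ≠ 0)
    (b : LinearMap.BilinForm F V) (u : Module.End F V)
    (hbu : IsSymplecticPair b u) (hu : IsExceptional p q u) :
    IsSymplecticDifference p q b u ↔
      ∀ k : ℕ, Odd k →
        4 ∣ {i : Fin (invariantFactors u).length | (invariantFactors u).get i =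
          (X ^ 2 - C (polyTrace p) * X + C (p.eval 0 + q.eval 0)) ^ k}.ncard := by
  obtain ⟨τ, a, hτ, ha⟩ : ∃ τ a, polyTrace p = τ ∧ p.eval 0 = a := ⟨_, _, rfl, rfl⟩
  obtain ⟨c, hc⟩ : ∃ c, q.eval 0 = c := ⟨_, rfl⟩
  have hp' := eq_quadPoly hp hp2
  have hq' := eq_quadPoly hq hq2
  rw [← htr] at hq'
  rw [hτ, ha] at hp'
  rw [hτ, hc] at hq'
  rw [hτ] at htr0 ⊢
  rw [ha, hc]
  subst hp' hq'
  have hd : Irreducible (quadPoly τ (a + c)) := irreducible_quadPoly_iff.2 fun r hr =>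
    hsplit (splittingFieldInClosure_quadPoly_eq_of_root hr)
  have := Fact.mk hd
  have hpd := irreducible_quadPoly_adjoinRoot htr0 hpi hqi
  have hX : X ^ 2 - C τ * X + C (a + c) = quadPoly τ (a + c) := by
    rw [quadPoly, CharTwo.sub_eq_add]
  obtain ⟨n, hn⟩ := hu.exists_pow_eq_zero
  -- Since F_{p,q} = d², exceptionality says that d(u) is nilpotent, so all invariant factors are
  -- powers of d.
  rw [fundamentalPolynomial_quadPoly, map_pow, ← pow_mul] at hn
  have hblock := (isInvariantFactorList_invariantFactors u).blockDim_eq hd (quadPoly_monic _ _) hn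
  rw [quadPoly_natDegree] at hblock
  rw [isSymplecticDifference_quadPoly_iff hbu, hX]
  constructor
  -- The index 2m counts the exponent 2m + 1, and deg d = 2 turns divisibility of `blockDim` by 8
  -- into divisibility of the count by 4.
  · rintro h k ⟨m, rfl⟩
    have h1 := h.eight_dvd_blockDim htr0 hpd hbu m
    rw [hblock] at h1
    omega
  · intro h
    refine hasPartner_of_eight_dvd_blockDim htr0 hd hbu hn fun m => ?_
    have h1 := h (2 * m + 1) ⟨m, rfl⟩
    rw [hblock]
    omega

end Main
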